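/- **Second four-parameter family for $\zeta(3)$.** For sequences of rational numbers $(a_n)_{n\ge0}$, $(b_n)_{n\ge0}$ with all $b_n\ne0$, consider the continued fraction $a_0+b_0/(a_1+b_1/(a_2+\cdots))$, with convergents $p_n/q_n=a_0+b_0/(a_1+\cdots+b_{n-1}/a_n)$; it converges to $z$ if $q_n\neq0$ for all large $n$ and $p_n/q_n\to z$. A pair of polynomials $(A,B)$ with rational coefficients *represents* $z$ if there is such a continued fraction converging to $z$ with $a_n=A(n)$ and $b_n=B(n)$ for all sufficiently large $n$. Let $u,v,w,k$ be nonnegative integers and put $$\begin{aligned}A(n)&=4(n+u+v+w-1)\bigl(4n^2+8(u+v+w-1)n+4u^2+8v^2+16w^2+12uv+16uw+24vw\\&\qquad-4u+4w+8k(u+2v+3w)+8k^2+8k+7\bigr),\\ B(n)&=-(2n-1)(2n+2u-1)(2n+2u+2v-1)(2n+2u+2v+4w-1)\\&\qquad\cdot(2n+2u+4v+4w-1)(2n+4u+4v+4w-1).\end{aligned}$$ Then: 1. $A(n)=8A_1(n-\tfrac12)$ and $B(n)=64B_1(n-\tfrac12)$, where $(A_1,B_1)$ is the first family, $$\begin{aligned}A_1(n)&=(2n+2(u+v+w)-1)\bigl(n^2+(2(u+v+w)-1)n+u^2+2v^2+4w^2\\&\qquad+3uv+4uw+6vw+v+2w+1+2k(u+2v+3w)+2k^2+2k\bigr),\\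 B_1(n)&=-n(n+u)(n+u+v)(n+u+v+2w)(n+u+2v+2w)(n+2u+2v+2w).\end{aligned}$$ 2. The pair $(A,B)$ represents $\zeta(3)$. 3. For every continued fraction $(a_n,b_n)$ as above (rational terms, $b_n\ne0$ for all $n$) that converges to $\zeta(3)$ and satisfies $a_n=A(n)$, $b_n=B(n)$ for all large $n$, there is a real constant $C\ne0$ such that $$\zeta(3)-\frac{p_n}{q_n}\sim\frac{C}{n^{2u+4v+6w+4k+2}}\qquad(n\to\infty).$$ -/

import Mathlib

open Filter Topology Polynomial Asymptotics

noncomputable section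

namespace ParamCF

/-- The continued fraction `a 0 + b 0 / (a 1 + b 1 / (a 2 + b 2 / (a 3 + ⋯)))`
attached to two sequences of rational numbers. Its `n`-th convergent
`convs n = nums n / dens n` is `p n / q n = a 0 + b 0 / (a 1 + ⋯ + b (n - 1) / a n)`. -/
def contFrac (a b : ℕ → ℚ) : GenContFract ℝ where
  h := (a 0 : ℝ)
  s := Stream'.Seq.ofStream fun n => ⟨(b n : ℝ), (a (n + 1) : ℝ)⟩

/-- The continued fraction converges to the real number `z`: only finitely many of the
denominators `q n` vanish, and `p n / q n` tends to `z`. -/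
def ConvergesTo (a b : ℕ → ℚ) (z : ℝ) : Prop :=
  (∀ᶠ n in atTop, (contFrac a b).dens n ≠ 0) ∧
    Tendsto (fun n => (contFrac a b).convs n) atTop (𝓝 z)

/-- `(a n, b n)` is a continued fraction (with nonzero partial numerators `b n`) that converges
to `z` and whose terms are `A(n)` and `B(n)` for all sufficiently large `n`. -/
structure IsRepresentation (A B : ℚ[X]) (z : ℝ) (a b : ℕ → ℚ) : Prop where
  num_ne_zero : ∀ n, b n ≠ 0
  convergesTo : ConvergesTo a b z
  eventually_eq : ∀ᶠ n : ℕ in atTop, a n = A.eval (n : ℚ) ∧ b n = B.eval (n : ℚ)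

/-- The pair of polynomials `(A, B)` represents `z`, written `z = (A(n), B(n))`. -/
def Represents (A B : ℚ[X]) (z : ℝ) : Prop :=
  ∃ a b : ℕ → ℚ, IsRepresentation A B z a b

/-- The real number `ζ(3)`. -/
def zetaThree : ℝ := (riemannZeta 3).re

theorem coe_zetaThree : (zetaThree : ℂ) = riemannZeta 3 := by
  have h : riemannZeta 3 = ((∑' n : ℕ, 1 / (n : ℝ) ^ 3 : ℝ) : ℂ) := by
    have := zeta_nat_eq_tsum_of_gt_one (k := 3) (by norm_num)
    push_cast at this ⊢
    exact this
  rw [zetaThree, h, Complex.ofReal_re]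

/-- The polynomial `A` of the first four-parameter family for `ζ(3)`
(the parameters are integers, seen as constant polynomials). -/
def firstA (u v w k : ℚ[X]) : ℚ[X] :=
  (2 * X + 2 * (u + v + w) - 1) *
    (X ^ 2 + (2 * (u + v + w) - 1) * X + u ^ 2 + 2 * v ^ 2 + 4 * w ^ 2
      + 3 * u * v + 4 * u * w + 6 * v * w + v + 2 * w + 1
      + 2 * k * (u + 2 * v + 3 * w) + 2 * k ^ 2 + 2 * k)

/-- The polynomial `B` of the first four-parameter family for `ζ(3)`
(the parameters are integers, seen as constant polynomials). -/
def firstB (u v w : ℚ[X]) : ℚ[X] :=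
  -(X * (X + u) * (X + u + v) * (X + u + v + 2 * w) * (X + u + 2 * v + 2 * w)
    * (X + 2 * u + 2 * v + 2 * w))

/-- The polynomial `A` of the second four-parameter family for `ζ(3)`
(the parameters are integers, seen as constant polynomials). -/
def secondA (u v w k : ℚ[X]) : ℚ[X] :=
  4 * (X + u + v + w - 1) *
    (4 * X ^ 2 + 8 * (u + v + w - 1) * X + 4 * u ^ 2 + 8 * v ^ 2 + 16 * w ^ 2
      + 12 * u * v + 16 * u * w + 24 * v * w - 4 * u + 4 * w
      + 8 * k * (u + 2 * v + 3 * w) + 8 * k ^ 2 + 8 * k + 7)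

/-- The polynomial `B` of the second four-parameter family for `ζ(3)`
(the parameters are integers, seen as constant polynomials). -/
def secondB (u v w : ℚ[X]) : ℚ[X] :=
  -((2 * X - 1) * (2 * X + 2 * u - 1) * (2 * X + 2 * u + 2 * v - 1)
    * (2 * X + 2 * u + 2 * v + 4 * w - 1) * (2 * X + 2 * u + 4 * v + 4 * w - 1)
    * (2 * X + 4 * u + 4 * v + 4 * w - 1))

end ParamCF

end

/-! Part 1 is substitution. For the rest, centre the recurrence at `N = n + u + v + w - 1/2`. The
roots of `B` then pair up as `±α, ±β, ±γ` with `α = w`, `β = v + w`, `γ = u + v + w`, and `A`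
depends on the parameters only through `α², β², γ²` and `τ²`, where `τ = α + β + γ + 2k + 1`. The
recurrence is thus symmetric in `α, β, γ` and even in each.

Arithmetic: a contiguity operator sends solutions for `(α, τ)` to solutions for `(α + 1, τ + 1)` and
multiplies the Casoratian by an explicit factor (`IsSol.shift`, `casoratian_shiftSol`). At `α = β =
γ = 0`, `τ = 1` the recurrence is solved by `∏ (j + 1/2)³` and by its product with the partial sums
of `∑ (j + 1/2)⁻³ = 7 ζ(3)`. Shifts, permutations and sign changes lead from there to all the
parameters needed (`hasRationalPair`).

Analysis: the normalised recurrence has a solution `D` of exact order `growth τ`. Summing the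
Casoratian gives a second solution `D * T` with `T` of exact order `m ^ (-2τ)` (`exists_basis`). A
combination `P - ζ(3) Q` negligible against `growth τ` is then a multiple of `D * T`. This gain of
`m ^ (-2τ)` absorbs the factor `m` lost by one contiguity step, so the limit `ζ(3)` survives every
shift.

Finally, the convergents of any representation are `(a₁ + b₁ T) / (a₂ + b₂ T)`. Their limit is `a₁ /
a₂` and their error is a nonzero multiple of `T` to leading order, which gives the exponent `2τ = 2u
+ 4v + 6w + 4k + 2`. -/

noncomputable section

namespace ParamCF

/-! ### The centred recurrence, its symmetries and its contiguity operator. -/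

section Algebra

variable {K : Type*} [Field K]

/-- The coefficient `A` of the recurrence, in the centred variable `N`. -/
def recA (α β γ τ N : K) : K :=
  (2 * N - 1) * (N ^ 2 - N + (1 + τ ^ 2 - α ^ 2 - β ^ 2 - γ ^ 2) / 2)

/-- The coefficient `B` of the recurrence, in the centred variable `N`. -/
def recB (α β γ N : K) : K :=
  -((N ^ 2 - α ^ 2) * (N ^ 2 - β ^ 2) * (N ^ 2 - γ ^ 2))

/-- The sequence `x`, whose `m`-th term sits at the half-integer `m - 1 / 2`, eventually satisfies
the recurrence with parameters `α, β, γ, τ`. -/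
def IsSol (α β γ τ : K) (x : ℕ → K) : Prop :=
  ∀ᶠ m : ℕ in atTop,
    x (m + 2) = recA α β γ τ ((m : K) + 3 / 2) * x (m + 1) + recB α β γ ((m : K) + 1 / 2) * x m

/-- The Casoratian of two sequences. -/
def casoratian (x y : ℕ → K) (m : ℕ) : K := x (m + 1) * y m - x m * y (m + 1)

/-- Coefficient of `x_N` in the contiguity relation. -/
def shiftF (α β γ τ N : K) : K :=
  -(N ^ 2 + (α + τ + 1) * N + ((α + τ + 1) ^ 2 - β ^ 2 - γ ^ 2) / 2)

/-- Coefficient of `x_{N-1}` in the contiguity relation. -/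
def shiftG (α β γ N : K) : K := (N + α) * (N ^ 2 - β ^ 2) * (N ^ 2 - γ ^ 2)

/-- The contiguity operator from the parameters `(α, τ)` to `(α + 1, τ + 1)`. -/
def shiftSol (α β γ τ : K) (x : ℕ → K) (m : ℕ) : K :=
  shiftF α β γ τ ((m : K) - 1 / 2) * x m + shiftG α β γ ((m : K) - 1 / 2) * x (m - 1)

theorem shiftSol_succ [CharZero K] (α β γ τ : K) (x : ℕ → K) (m : ℕ) :
    shiftSol α β γ τ x (m + 1) =
      shiftF α β γ τ ((m : K) + 1 / 2) * x (m + 1) + shiftG α β γ ((m : K) + 1 / 2) * x m := by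
  have h : ((m + 1 : ℕ) : K) - 1 / 2 = (m : K) + 1 / 2 := by push_cast; ring
  simp only [shiftSol, h, Nat.add_sub_cancel]

/-- The new recurrence for the shifted sequence is a combination of two consecutive instances of the
old one, with multipliers `shiftF` and `c`. The identities `k0`, `k1`, `k2` compare the coefficients
of `x0`, `x2`, `x1`. -/
theorem IsSol.shift [CharZero K] {α β γ τ : K} {x : ℕ → K} (hx : IsSol α β γ τ x) :
    IsSol (α + 1) β γ (τ + 1) (shiftSol α β γ τ x) := by
  obtain ⟨m₀, h⟩ := eventually_atTop.mp hx
  refine eventually_atTop.mpr ⟨m₀ + 1, fun n hn => ?_⟩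
  obtain ⟨m, rfl⟩ : ∃ m, n = m + 1 := ⟨n - 1, by omega⟩
  have h0 := h m (by omega)
  have h1 := h (m + 1) (by omega)
  rw [show m + 1 + 2 = m + 2 + 1 by ring, shiftSol_succ, shiftSol_succ, shiftSol_succ]
  rw [show m + 1 + 2 = m + 2 + 1 by ring] at h1
  push_cast at h0 h1 ⊢
  generalize (m : K) = M at *
  generalize x (m + 2 + 1) = x3, x (m + 2) = x2 at *
  generalize x (m + 1) = x1, x m = x0 at *
  have k0 : recB (α + 1) β γ (M + 1 + 1 / 2) * shiftG α β γ (M + 1 / 2) =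
      ((M + 3 / 2 + α + 1) * ((M + 3 / 2) ^ 2 - β ^ 2) * ((M + 3 / 2) ^ 2 - γ ^ 2))
        * recB α β γ (M + 1 / 2) := by
    simp only [recB, shiftG]; ring
  have k1 : shiftF α β γ τ (M + 2 + 1 / 2) * recA α β γ τ (M + 1 + 3 / 2)
      + shiftG α β γ (M + 2 + 1 / 2) =
      recA (α + 1) β γ (τ + 1) (M + 1 + 3 / 2) * shiftF α β γ τ (M + 1 + 1 / 2) +
      ((M + 3 / 2 + α + 1) * ((M + 3 / 2) ^ 2 - β ^ 2) * ((M + 3 / 2) ^ 2 - γ ^ 2)) := by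
    simp only [recA, shiftF, shiftG]; ring
  have k2 : shiftF α β γ τ (M + 2 + 1 / 2) * recB α β γ (M + 1 + 1 / 2) =
      recA (α + 1) β γ (τ + 1) (M + 1 + 3 / 2) * shiftG α β γ (M + 1 + 1 / 2)
      + recB (α + 1) β γ (M + 1 + 1 / 2) * shiftF α β γ τ (M + 1 / 2)
      - ((M + 3 / 2 + α + 1) * ((M + 3 / 2) ^ 2 - β ^ 2) * ((M + 3 / 2) ^ 2 - γ ^ 2))
        * recA α β γ τ (M + 3 / 2) := by
    simp only [recA, recB, shiftF, shiftG]; ring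
  generalize ((M + 3 / 2 + α + 1) * ((M + 3 / 2) ^ 2 - β ^ 2) * ((M + 3 / 2) ^ 2 - γ ^ 2)) = c at *
  linear_combination shiftF α β γ τ (M + 2 + 1 / 2) * h1 + x2 * k1 + x1 * k2 - x0 * k0 + c * h0

/-- The shift acts on pairs of consecutive values by a 2 × 2 matrix, whose determinant factors. The
factor on the left turns `shiftG` into `-recB`, so that the recurrence can eliminate `x m` and `y
m`. -/
theorem casoratian_shiftSol [CharZero K] {α β γ τ : K} {x y : ℕ → K} {m : ℕ}
    (hx : x (m + 2) = recA α β γ τ ((m : K) + 3 / 2) * x (m + 1)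
      + recB α β γ ((m : K) + 1 / 2) * x m)
    (hy : y (m + 2) = recA α β γ τ ((m : K) + 3 / 2) * y (m + 1)
      + recB α β γ ((m : K) + 1 / 2) * y m) :
    ((m : K) + 1 / 2 - α) * casoratian (shiftSol α β γ τ x) (shiftSol α β γ τ y) (m + 1) =
      -((α + τ + 1) ^ 2 - (β - γ) ^ 2) * ((α + τ + 1) ^ 2 - (β + γ) ^ 2) / 4
        * ((m : K) + 3 / 2 + α) * casoratian x y (m + 1) := by
  have e : ((m + 1 : ℕ) : K) + 1 / 2 = (m : K) + 3 / 2 := by push_cast; ring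
  simp only [casoratian, shiftSol_succ, e]
  generalize (m : K) = M at *
  generalize x (m + 1 + 1) = x2, x (m + 1) = x1, x m = x0, y (m + 1 + 1) = y2,
    y (m + 1) = y1, y m = y0 at *
  have k0 : (M + 1 / 2 - α) * shiftG α β γ (M + 1 / 2) = -recB α β γ (M + 1 / 2) := by
    simp only [recB, shiftG]; ring
  have k1 : shiftF α β γ τ (M + 3 / 2) * ((M + 1 / 2 - α) * shiftF α β γ τ (M + 1 / 2)
      + recA α β γ τ (M + 3 / 2)) + shiftG α β γ (M + 3 / 2) =
      -((α + τ + 1) ^ 2 - (β - γ) ^ 2) * ((α + τ + 1) ^ 2 - (β + γ) ^ 2) / 4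
        * (M + 3 / 2 + α) := by
    simp only [recA, shiftF, shiftG]; ring
  linear_combination (shiftF α β γ τ (M + 3 / 2) * x2 + shiftG α β γ (M + 3 / 2) * x1)
      * (y0 * k0 + hy)
    - (shiftF α β γ τ (M + 3 / 2) * y2 + shiftG α β γ (M + 3 / 2) * y1)
      * (x0 * k0 + hx) + (x2 * y1 - x1 * y2) * k1

theorem IsSol.swap {α β γ τ : K} {x : ℕ → K} (hx : IsSol α β γ τ x) : IsSol β α γ τ x := by
  filter_upwards [hx] with m hm
  rw [hm]; simp only [recA, recB]; ring

theorem IsSol.rotate {α β γ τ : K} {x : ℕ → K} (hx : IsSol α β γ τ x) : IsSol β γ α τ x := by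
  filter_upwards [hx] with m hm
  rw [hm]; simp only [recA, recB]; ring

theorem IsSol.neg {α β γ τ : K} {x : ℕ → K} (hx : IsSol α β γ τ x) : IsSol (-α) β γ τ x := by
  filter_upwards [hx] with m hm
  rw [hm]; simp only [recA, recB]; ring

end Algebra

/-! ### Perturbed recurrences, infinite products and tails of series. -/

section Analysis

/-- A second-order recurrence `z (m+2) - z (m+1) = b m * (z (m+1) - z m) + η m * z (m+1)` that is a
small perturbation of a contracting one has a solution with a nonzero limit. -/
theorem exists_recurrence_tendsto_ne_zero {b η : ℕ → ℝ} {C : ℝ}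
    (hb : ∀ᶠ m : ℕ in atTop, 0 ≤ b m ∧ b m ≤ 1 - 5 / 2 / m)
    (hη : ∀ᶠ m : ℕ in atTop, |η m| ≤ C / (m : ℝ) ^ 3) :
    ∃ z : ℕ → ℝ, ∃ l ≠ 0, Tendsto z atTop (𝓝 l) ∧
      ∀ᶠ m in atTop, z (m + 2) - z (m + 1) = b m * (z (m + 1) - z m) + η m * z (m + 1) := by
  have hC : 0 ≤ C := by
    obtain ⟨m, h1, h2⟩ := (hη.and (eventually_ge_atTop 1)).exists
    have : (0 : ℝ) < (m : ℝ) ^ 3 := by positivity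
    have := (abs_nonneg _).trans h1
    by_contra! hC
    exact absurd this (not_le.mpr (div_neg_of_neg_of_pos hC (by assumption)))
  obtain ⟨m₀, h⟩ := eventually_atTop.mp (hb.and hη)
  obtain ⟨m₁, hm₁⟩ := exists_nat_gt (6 * C + 1)
  -- The invariant is `|z (m+1) - z m| ≤ M / m²` with `|z - 1| ≤ 1/2`. For `M = 3C`, `5/2 * M - 3/2
  -- * C = 2M`, just enough to pass from `m⁻²` to `(m+1)⁻²`; `k > 6C + 1` keeps the total drift
  -- below `1/2`.
  obtain ⟨M, hM⟩ : ∃ M, M = 3 * C := ⟨_, rfl⟩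
  have hM0 : 0 ≤ M := by rw [hM]; positivity
  obtain ⟨k, hk0, hk2, hk1⟩ : ∃ k : ℕ, m₀ ≤ k ∧ 2 ≤ k ∧ 6 * C + 1 < k :=
    ⟨m₀ + m₁ + 2, by omega, by omega, by push_cast; linarith [(Nat.cast_nonneg m₀ : (0 : ℝ) ≤ m₀)]⟩
  -- `s m` is the pair `(z m, z (m+1) - z m)`, started at `(1, 0)` at index `k`.
  obtain ⟨s, hs, hs0⟩ : ∃ s : ℕ → ℝ × ℝ, (∀ m, k ≤ m →
      s (m + 1) = ((s m).1 + (s m).2, b m * (s m).2 + η m * ((s m).1 + (s m).2))) ∧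
      s k = (1, 0) := by
    refine ⟨fun m => Nat.rec (1, 0) (fun m p =>
      if m < k then (1, 0) else (p.1 + p.2, b m * p.2 + η m * (p.1 + p.2))) m,
      fun m hm => if_neg (not_lt.mpr hm), ?_⟩
    obtain ⟨j, hj⟩ : ∃ j, k = j + 1 := ⟨k - 1, by omega⟩
    rw [hj]
    exact if_pos (by omega)
  have hk' : (1 : ℝ) < k := by exact_mod_cast hk2
  have key : ∀ m, k ≤ m → |(s m).2| ≤ M / (m : ℝ) ^ 2 ∧
      |(s m).1 - 1| ≤ M / ((k : ℝ) - 1) - M / ((m : ℝ) - 1) := by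
    intro m hm
    induction m, hm using Nat.le_induction with
    | base =>
      rw [hs0]; simp; positivity
    | succ m hm ih =>
      obtain ⟨ih1, ih2⟩ := ih
      have hkm : (k : ℝ) ≤ m := by exact_mod_cast hm
      have hm1 : (1 : ℝ) < m := by linarith
      have hm0 : (0 : ℝ) < m := by linarith
      rw [hs m hm]
      push_cast
      have e1 : |(s m).1 + (s m).2 - 1| ≤ M / ((k : ℝ) - 1) - M / (m : ℝ) := by
        have : M / (m : ℝ) ^ 2 ≤ M / ((m : ℝ) - 1) - M / m := by
          rw [div_sub_div _ _ (by linarith) (by linarith), div_le_div_iff₀ (by positivity)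
            (by nlinarith)]
          have : 0 ≤ M * m := by positivity
          nlinarith
        calc |(s m).1 + (s m).2 - 1| = |((s m).1 - 1) + (s m).2| := by ring_nf
          _ ≤ |(s m).1 - 1| + |(s m).2| := abs_add_le _ _
          _ ≤ _ := by linarith
      have e2 : |(s m).1 + (s m).2| ≤ 3 / 2 := by
        have h3 : M / ((k : ℝ) - 1) ≤ 1 / 2 := by
          rw [div_le_iff₀ (by linarith)]; linarith
        have h4 : 0 ≤ M / (m : ℝ) := by positivity
        have := abs_le.mp e1
        exact abs_le.mpr ⟨by linarith, by linarith⟩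
      refine ⟨?_, ?_⟩
      · obtain ⟨⟨hb0, hb1⟩, hη1⟩ := h m (hk0.trans hm)
        calc |b m * (s m).2 + η m * ((s m).1 + (s m).2)|
            ≤ |b m * (s m).2| + |η m * ((s m).1 + (s m).2)| := abs_add_le _ _
          _ = b m * |(s m).2| + |η m| * |(s m).1 + (s m).2| := by
              rw [abs_mul, abs_mul, abs_of_nonneg hb0]
          _ ≤ (1 - 5 / 2 / m) * (M / (m : ℝ) ^ 2) + C / (m : ℝ) ^ 3 * (3 / 2) := by
              gcongr
              exact hb0.trans hb1
          _ = M * ((m : ℝ) - 2) / (m : ℝ) ^ 3 := by rw [hM]; field_simp; ring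
          _ ≤ M / ((m : ℝ) + 1) ^ 2 := by
              rw [div_le_div_iff₀ (by positivity) (by positivity)]
              have : M * ((m : ℝ) - 2) * ((m : ℝ) + 1) ^ 2 =
                  M * (m : ℝ) ^ 3 - M * (3 * (m : ℝ) + 2) := by ring
              have : 0 ≤ M * (3 * (m : ℝ) + 2) := by positivity
              linarith
      · simpa using e1
  have hd : ∀ m, k ≤ m → |(s m).2| ≤ M / (m : ℝ) ^ 2 := fun m hm => (key m hm).1
  have hsum : Summable fun m : ℕ => M / (m : ℝ) ^ 2 := by
    simpa [div_eq_mul_inv] using (Real.summable_nat_pow_inv.mpr one_lt_two).mul_left M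
  have hsum' : Summable fun m : ℕ => M / ((m + k : ℕ) : ℝ) ^ 2 :=
    (summable_nat_add_iff (f := fun m : ℕ => M / (m : ℝ) ^ 2) k).mpr hsum
  have hcau : CauchySeq fun m => (s (m + k)).1 := by
    refine cauchySeq_of_dist_le_of_summable (fun m => M / ((m + k : ℕ) : ℝ) ^ 2) (fun m => ?_)
      hsum'
    rw [Nat.succ_eq_add_one, show m + 1 + k = m + k + 1 by ring, hs (m + k) (by omega),
      Real.dist_eq, abs_sub_comm]
    simpa using hd (m + k) (by omega)
  obtain ⟨l, hl⟩ := cauchySeq_tendsto_of_complete hcau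
  have hl' : Tendsto (fun m => (s m).1) atTop (𝓝 l) := (tendsto_add_atTop_iff_nat k).mp hl
  refine ⟨fun m => (s m).1, l, ?_, hl', ?_⟩
  · have : (1 / 2 : ℝ) ≤ l := by
      refine ge_of_tendsto hl' (eventually_atTop.mpr ⟨k, fun m hm => ?_⟩)
      have h3 : M / ((k : ℝ) - 1) ≤ 1 / 2 := by
        rw [div_le_iff₀ (by linarith)]; linarith
      have hkm : (k : ℝ) ≤ m := by exact_mod_cast hm
      have h4 : 0 ≤ M / ((m : ℝ) - 1) := by
        have : 0 < (m : ℝ) - 1 := by linarith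
        positivity
      have := abs_le.mp (key m hm).2
      linarith
    linarith
  · refine eventually_atTop.mpr ⟨k, fun m hm => ?_⟩
    have h1 := hs m hm
    have h2 := hs (m + 1) (by omega)
    simp only [show m + 2 = m + 1 + 1 from rfl, h2, h1]
    ring

/-- A sequence with ratios `1 + ε m`, `ε` summable, converges to a nonzero limit. -/
theorem exists_tendsto_ne_zero_of_ratio {w ε : ℕ → ℝ} (hε : Summable ε)
    (hw : ∀ᶠ m in atTop, w (m + 1) = (1 + ε m) * w m) (hw0 : ∀ᶠ m in atTop, w m ≠ 0) :
    ∃ c ≠ 0, Tendsto w atTop (𝓝 c) := by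
  obtain ⟨k, h⟩ := eventually_atTop.mp (hw.and hw0)
  have hε' : Summable fun i => ε (i + k) := (summable_nat_add_iff k).mpr hε
  have hm : Multipliable fun i => 1 + ε (i + k) := Real.multipliable_one_add_of_summable hε'
  have h1 : ∀ i, 1 + ε (i + k) ≠ 0 := by
    intro i hi
    have h2 := (h (i + k) (by omega)).1
    rw [hi, zero_mul] at h2
    exact (h (i + k + 1) (by omega)).2 h2
  have hne : ∏' i, (1 + ε (i + k)) ≠ 0 := tprod_one_add_ne_zero_of_summable h1 hε'.norm
  refine ⟨(∏' i, (1 + ε (i + k))) * w k, mul_ne_zero hne (h k le_rfl).2, ?_⟩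
  refine (tendsto_add_atTop_iff_nat k).mp ?_
  have h3 : ∀ n, w (n + k) = (∏ i ∈ Finset.range n, (1 + ε (i + k))) * w k := by
    intro n
    induction n with
    | zero => simp
    | succ n ih =>
      rw [Finset.prod_range_succ, show n + 1 + k = n + k + 1 by ring, (h (n + k) (by omega)).1, ih]
      ring
  simp only [h3]
  exact hm.hasProd.tendsto_prod_nat.mul_const _

/-- If `V` is asymptotically `c` times the decrements of a sequence `v` decreasing to `0`, then `V`
is the difference of a sequence asymptotic to `-c * v`. -/
theorem exists_antidifference_tendsto {V v : ℕ → ℝ} {c : ℝ}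
    (hv : ∀ m, v (m + 1) < v m) (hv0 : Tendsto v atTop (𝓝 0))
    (h : Tendsto (fun m => V m / (v m - v (m + 1))) atTop (𝓝 c)) :
    ∃ T : ℕ → ℝ, (∀ m, T (m + 1) - T m = V m) ∧
      Tendsto (fun m => T m / v m) atTop (𝓝 (-c)) := by
  have hanti : StrictAnti v := strictAnti_nat_of_succ_lt hv
  have hpos : ∀ m, 0 < v m := fun m =>
    lt_of_le_of_lt (hanti.antitone.le_of_tendsto hv0 (m + 1)) (hv m)
  let S : ℕ → ℝ := fun m => ∑ j ∈ Finset.range m, V j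
  have hS : ∀ m, S (m + 1) - S m = V m := fun m => by simp [S, Finset.sum_range_succ]
  -- A Stolz–Cesàro estimate on finite blocks; letting `n → ∞` gives the asymptotics of the tail `S
  -- m - L`.
  have step : ∀ e > 0, ∃ k, ∀ m ≥ k, ∀ n ≥ m,
      |S n - S m - c * (v m - v n)| ≤ e * (v m - v n) := by
    intro e he
    obtain ⟨k, hk⟩ := eventually_atTop.mp ((Metric.tendsto_nhds.mp h) e he)
    refine ⟨k, fun m hm n hn => ?_⟩
    induction n, hn using Nat.le_induction with
    | base => simp
    | succ n hn ih =>
      have h1 := hk n (by omega)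
      have hd : 0 < v n - v (n + 1) := sub_pos.mpr (hv n)
      have h2 : |V n - c * (v n - v (n + 1))| ≤ e * (v n - v (n + 1)) := by
        rw [Real.dist_eq] at h1
        have : V n - c * (v n - v (n + 1)) = (V n / (v n - v (n + 1)) - c) * (v n - v (n + 1)) := by
          field_simp
        rw [this, abs_mul, abs_of_pos hd]
        gcongr
      calc |S (n + 1) - S m - c * (v m - v (n + 1))|
          = |(S n - S m - c * (v m - v n)) + (V n - c * (v n - v (n + 1)))| := by
            rw [← hS n]; ring_nf
        _ ≤ _ := abs_add_le _ _
        _ ≤ e * (v m - v (n + 1)) := by linarith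
  have hcau : CauchySeq S := by
    obtain ⟨k, hk⟩ := step 1 one_pos
    refine Metric.cauchySeq_iff'.mpr fun e he => ?_
    have h1 : ∀ᶠ m in atTop, (1 + |c|) * v m < e := by
      have := hv0.const_mul (1 + |c|)
      rw [mul_zero] at this
      exact this.eventually_lt_const he
    obtain ⟨N, hN, hN'⟩ := (h1.and (eventually_ge_atTop k)).exists
    refine ⟨N, fun n hn => ?_⟩
    have h2 := hk N hN' n hn
    have h3 : 0 ≤ v N - v n := sub_nonneg.mpr (hanti.antitone hn)
    rw [Real.dist_eq]
    calc |S n - S N| = |(S n - S N - c * (v N - v n)) + c * (v N - v n)| := by ring_nf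
      _ ≤ |S n - S N - c * (v N - v n)| + |c * (v N - v n)| := abs_add_le _ _
      _ ≤ 1 * (v N - v n) + |c| * (v N - v n) := by
        rw [abs_mul c, abs_of_nonneg h3]; gcongr
      _ ≤ (1 + |c|) * v N := by
        nlinarith [mul_nonneg (add_nonneg zero_le_one (abs_nonneg c)) (hpos n).le]
      _ < e := hN
  obtain ⟨L, hL⟩ := cauchySeq_tendsto_of_complete hcau
  refine ⟨fun m => S m - L, fun m => by simpa using hS m, ?_⟩
  rw [Metric.tendsto_nhds]
  intro e he
  obtain ⟨k, hk⟩ := step (e / 2) (half_pos he)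
  filter_upwards [eventually_ge_atTop k] with m hm
  have h1 : |L - S m - c * (v m - 0)| ≤ e / 2 * (v m - 0) := by
    refine le_of_tendsto_of_tendsto ?_ ?_ (eventually_atTop.mpr ⟨m, hk m hm⟩)
    · exact ((hL.sub_const _).sub ((hv0.const_sub _).const_mul _)).abs
    · exact (hv0.const_sub _).const_mul _
  have hvm := hpos m
  rw [Real.dist_eq]
  have : (S m - L) / v m - -c = -(L - S m - c * (v m - 0)) / v m := by field_simp; ring
  rw [this, abs_div, abs_neg, abs_of_pos hvm, div_lt_iff₀ hvm]
  nlinarith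

theorem exists_abs_one_add_pow_sub_le (k : ℕ) :
    ∃ C : ℝ, 0 ≤ C ∧ ∀ x : ℝ, 0 ≤ x → x ≤ 1 → |(1 + x) ^ k - 1 - k * x| ≤ C * x ^ 2 := by
  induction k with
  | zero => exact ⟨0, le_rfl, fun x _ _ => by simp⟩
  | succ k ih =>
    obtain ⟨C, hC, h⟩ := ih
    refine ⟨2 * C + k, by positivity, fun x h0 h1 => ?_⟩
    have : (1 + x) ^ (k + 1) - 1 - ((k + 1 : ℕ) : ℝ) * x =
        (1 + x) * ((1 + x) ^ k - 1 - k * x) + k * x ^ 2 := by push_cast; ring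
    rw [this]
    calc _ ≤ |(1 + x) * ((1 + x) ^ k - 1 - k * x)| + |k * x ^ 2| := abs_add_le _ _
      _ = (1 + x) * |(1 + x) ^ k - 1 - k * x| + k * x ^ 2 := by
        rw [abs_mul, abs_of_nonneg (by linarith : 0 ≤ 1 + x),
          abs_of_nonneg (by positivity : 0 ≤ (k : ℝ) * x ^ 2)]
      _ ≤ 2 * (C * x ^ 2) + k * x ^ 2 := by
        gcongr
        · linarith
        · exact h x h0 h1
      _ = _ := by ring

end Analysis

/-! ### Dominant and minimal solutions with exact asymptotics. -/

section Basis

theorem exists_eventually_eq_of_eventually_succ_eq {K : Type*} {f : ℕ → K}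
    (h : ∀ᶠ m in atTop, f (m + 1) = f m) : ∃ a, ∀ᶠ m in atTop, f m = a := by
  obtain ⟨k, hk⟩ := eventually_atTop.mp h
  refine ⟨f k, eventually_atTop.mpr ⟨k, fun m hm => ?_⟩⟩
  induction m, hm using Nat.le_induction with
  | base => rfl
  | succ m hm ih => rw [hk m hm, ih]

theorem casoratian_succ {K : Type*} [Field K] {α β γ τ : K} {x y : ℕ → K} (hx : IsSol α β γ τ x)
    (hy : IsSol α β γ τ y) :
    ∀ᶠ m : ℕ in atTop, casoratian x y (m + 1) =
      -recB α β γ ((m : K) + 1 / 2) * casoratian x y m := by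
  filter_upwards [hx, hy] with m h1 h2
  simp only [casoratian]
  rw [show m + 1 + 1 = m + 2 from rfl, h1, h2]
  ring

/-- The ratio of consecutive terms of `growth τ`, in the centred variable `N`. -/
def growthRatio (τ : ℕ) (N : ℝ) : ℝ := N ^ 2 * (N + τ - 1)

/-- The growth rate of the dominant solutions of the recurrence with parameter `τ`. -/
def growth (τ m : ℕ) : ℝ := ∏ j ∈ Finset.range m, growthRatio τ ((j : ℝ) + 1 / 2)

theorem growth_succ (τ m : ℕ) :
    growth τ (m + 1) = growth τ m * growthRatio τ ((m : ℝ) + 1 / 2) :=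
  Finset.prod_range_succ _ _

theorem growthRatio_pos {τ : ℕ} (hτ : 1 ≤ τ) {N : ℝ} (hN : 0 < N) : 0 < growthRatio τ N := by
  have : (1 : ℝ) ≤ τ := by exact_mod_cast hτ
  have : 0 < N + τ - 1 := by linarith
  unfold growthRatio; positivity

theorem growth_pos {τ : ℕ} (hτ : 1 ≤ τ) (m : ℕ) : 0 < growth τ m :=
  Finset.prod_pos fun _ _ => growthRatio_pos hτ (by positivity)

theorem pow_three_le_growthRatio {τ : ℕ} (hτ : 1 ≤ τ) (N : ℝ) :
    N ^ 3 ≤ growthRatio τ N := by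
  have : (1 : ℝ) ≤ τ := by exact_mod_cast hτ
  unfold growthRatio
  nlinarith [mul_nonneg (sq_nonneg N) (sub_nonneg.mpr this)]

theorem pow_six_le_growthRatio_mul {τ : ℕ} (hτ : 1 ≤ τ) {N : ℝ} (hN : 0 < N) :
    N ^ 6 ≤ growthRatio τ N * growthRatio τ (N + 1) := by
  have h1 := pow_three_le_growthRatio hτ N
  have h2 := pow_three_le_growthRatio hτ (N + 1)
  have h3 : N ^ 3 ≤ (N + 1) ^ 3 := by gcongr; linarith
  calc N ^ 6 = N ^ 3 * N ^ 3 := by ring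
    _ ≤ _ := mul_le_mul h1 (h3.trans h2) (by positivity) (growthRatio_pos hτ hN).le

/-- The Casoratian ratio of the recurrence normalised by `growth τ`. -/
def normB (α β γ : ℝ) (τ : ℕ) (N : ℝ) : ℝ :=
  -recB α β γ N / (growthRatio τ N * growthRatio τ (N + 1))

/-- The defect of the normalised recurrence. -/
def normE (α β γ : ℝ) (τ : ℕ) (N : ℝ) : ℝ :=
  recA α β γ τ (N + 1) / growthRatio τ (N + 1) - 1 - normB α β γ τ N

/-- This explains the choice of `growthRatio`. With the ratio `N² (N + σ)` the numerator of the
defect has no terms in `N⁶` and `N⁵`, and its `N⁴` coefficient is `τ² - (σ + 1)²`, which vanishes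
for `σ = τ - 1`. -/
theorem exists_abs_normE_le (α β γ : ℝ) {τ : ℕ} (hτ : 1 ≤ τ) :
    ∃ C, ∀ N : ℝ, 1 ≤ N → |normE α β γ τ N| ≤ C / N ^ 3 := by
  obtain ⟨K, hK⟩ : ∃ K : ℝ, K = (1 + (τ : ℝ) ^ 2 - α ^ 2 - β ^ 2 - γ ^ 2) / 2 := ⟨_, rfl⟩
  obtain ⟨c3, h3⟩ : ∃ c : ℝ, c = K - τ + (2 * K - 2 * τ) * (τ - 1) := ⟨_, rfl⟩
  obtain ⟨c2, h2⟩ : ∃ c : ℝ, c = (K - τ) * (τ - 1)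
    - (α ^ 2 * β ^ 2 + β ^ 2 * γ ^ 2 + γ ^ 2 * α ^ 2) := ⟨_, rfl⟩
  obtain ⟨c0, h0⟩ : ∃ c : ℝ, c = α ^ 2 * β ^ 2 * γ ^ 2 := ⟨_, rfl⟩
  refine ⟨|c3| + |c2| + |c0|, fun N hN => ?_⟩
  have hN0 : 0 < N := by linarith
  have g0 := growthRatio_pos hτ hN0
  have g1 := growthRatio_pos hτ (by linarith : 0 < N + 1)
  have e : normE α β γ τ N =
      (c3 * N ^ 3 + c2 * N ^ 2 + c0) / (growthRatio τ N * growthRatio τ (N + 1)) := by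
    rw [normE, normB, eq_div_iff (by positivity)]
    have : (recA α β γ τ (N + 1) / growthRatio τ (N + 1) - 1 - -recB α β γ N /
        (growthRatio τ N * growthRatio τ (N + 1))) * (growthRatio τ N * growthRatio τ (N + 1)) =
        recA α β γ τ (N + 1) * growthRatio τ N - growthRatio τ N * growthRatio τ (N + 1)
          + recB α β γ N := by
      field_simp; ring
    rw [this]
    simp only [recA, recB, growthRatio, h3, h2, h0, hK]
    ring
  rw [e, abs_div, abs_of_pos (mul_pos g0 g1)]
  calc _ ≤ ((|c3| + |c2| + |c0|) * N ^ 3) / N ^ 6 := by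
        have hb : |c3 * N ^ 3 + c2 * N ^ 2 + c0| ≤ (|c3| + |c2| + |c0|) * N ^ 3 := by
          have a1 : N ^ 2 ≤ N ^ 3 := pow_le_pow_right₀ hN (by norm_num)
          have a2 : 1 ≤ N ^ 3 := one_le_pow₀ hN
          calc _ ≤ |c3 * N ^ 3| + |c2 * N ^ 2| + |c0| := abs_add_three _ _ _
            _ = |c3| * N ^ 3 + |c2| * N ^ 2 + |c0| * 1 := by
              rw [abs_mul, abs_mul, abs_of_pos (by positivity : 0 < N ^ 3),
                abs_of_pos (by positivity : 0 < N ^ 2), mul_one]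
            _ ≤ |c3| * N ^ 3 + |c2| * N ^ 3 + |c0| * N ^ 3 := by gcongr
            _ = _ := by ring
        gcongr
        exact pow_six_le_growthRatio_mul hτ hN0
    _ = _ := by field_simp

theorem exists_abs_normB_le (α β γ : ℝ) {τ : ℕ} (hτ : 1 ≤ τ) :
    ∃ C, 0 ≤ C ∧ ∀ N : ℝ, 1 ≤ N →
      |normB α β γ τ N - (1 - (2 * τ + 1) / N)| ≤ C / N ^ 2 := by
  obtain ⟨κ, hκ⟩ : ∃ κ : ℝ, κ = 2 * τ + 1 := ⟨_, rfl⟩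
  obtain ⟨h, hh⟩ : ∃ h : ℝ, h = (τ : ℝ) ^ 2 - τ := ⟨_, rfl⟩
  obtain ⟨c5, h5⟩ : ∃ c : ℝ, c = h + 4 * τ - 1 + (α ^ 2 + β ^ 2 + γ ^ 2) - κ ^ 2 := ⟨_, rfl⟩
  obtain ⟨c4, h4⟩ : ∃ c : ℝ, c = 2 * h + 2 * τ - 1 - κ * (h + 4 * τ - 1) := ⟨_, rfl⟩
  obtain ⟨c3, h3⟩ : ∃ c : ℝ, c = h - (α ^ 2 * β ^ 2 + β ^ 2 * γ ^ 2 + γ ^ 2 * α ^ 2)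
    - κ * (2 * h + 2 * τ - 1) := ⟨_, rfl⟩
  obtain ⟨c2, h2⟩ : ∃ c : ℝ, c = -κ * h := ⟨_, rfl⟩
  obtain ⟨c1, h1⟩ : ∃ c : ℝ, c = α ^ 2 * β ^ 2 * γ ^ 2 := ⟨_, rfl⟩
  refine ⟨|c5| + |c4| + |c3| + |c2| + |c1|, by positivity, fun N hN => ?_⟩
  have hN0 : 0 < N := by linarith
  have g0 := growthRatio_pos hτ hN0
  have g1 := growthRatio_pos hτ (by linarith : 0 < N + 1)
  have e : normB α β γ τ N - (1 - (2 * τ + 1) / N) =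
      -(c5 * N ^ 5 + c4 * N ^ 4 + c3 * N ^ 3 + c2 * N ^ 2 + c1 * N ^ 1) /
        (N * (growthRatio τ N * growthRatio τ (N + 1))) := by
    rw [normB, eq_div_iff (by positivity), ← hκ]
    have : (-recB α β γ N / (growthRatio τ N * growthRatio τ (N + 1)) - (1 - κ / N)) *
        (N * (growthRatio τ N * growthRatio τ (N + 1))) =
        -(N * (growthRatio τ N * growthRatio τ (N + 1) + recB α β γ N)
          - κ * (growthRatio τ N * growthRatio τ (N + 1))) := by
      field_simp; ring
    rw [this]
    simp only [recB, growthRatio, h5, h4, h3, h2, h1, hκ, hh]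
    ring
  have hb : ∀ (c : ℝ) (i : ℕ), i ≤ 5 → |c * N ^ i| ≤ |c| * N ^ 5 := fun c i hi => by
    rw [abs_mul, abs_of_pos (by positivity : 0 < N ^ i)]
    gcongr
  rw [e, abs_div, abs_neg, abs_of_pos (mul_pos hN0 (mul_pos g0 g1))]
  calc _ ≤ ((|c5| + |c4| + |c3| + |c2| + |c1|) * N ^ 5) / (N * N ^ 6) := by
        have hb : |c5 * N ^ 5 + c4 * N ^ 4 + c3 * N ^ 3 + c2 * N ^ 2 + c1 * N ^ 1| ≤
            (|c5| + |c4| + |c3| + |c2| + |c1|) * N ^ 5 := by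
          refine (abs_add_le _ _).trans ?_
          refine (add_le_add_left ((abs_add_le _ _).trans
            (add_le_add_left (abs_add_three _ _ _) _)) _).trans ?_
          linarith [hb c5 5 (by norm_num), hb c4 4 (by norm_num), hb c3 3 (by norm_num),
            hb c2 2 (by norm_num), hb c1 1 (by norm_num)]
        gcongr
        exact pow_six_le_growthRatio_mul hτ hN0
    _ = _ := by field_simp

/-- Since `2τ + 1 ≥ 3`, the expansion of `normB` leaves room for any constant below `3`; `5/2` also
exceeds the `2` needed for decrements of order `m⁻²`. -/
theorem eventually_normB_bounds (α β γ : ℝ) {τ : ℕ} (hτ : 1 ≤ τ) :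
    ∀ᶠ m : ℕ in atTop, 0 < normB α β γ τ ((m : ℝ) + 1 / 2) ∧
      normB α β γ τ ((m : ℝ) + 1 / 2) ≤ 1 - 5 / 2 / m := by
  obtain ⟨C, hC, h⟩ := exists_abs_normB_le α β γ hτ
  obtain ⟨k, hk⟩ := exists_nat_gt (4 * C + 5 + 4 * (2 * τ + 1))
  have hτ' : (1 : ℝ) ≤ τ := by exact_mod_cast hτ
  filter_upwards [eventually_ge_atTop k] with m hm
  have hm' : (4 * C + 5 + 4 * (2 * τ + 1) : ℝ) < m := hk.trans_le (by exact_mod_cast hm)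
  have hm0 : (0 : ℝ) < m := by linarith
  obtain ⟨N, hN⟩ : ∃ N : ℝ, N = (m : ℝ) + 1 / 2 := ⟨_, rfl⟩
  rw [← hN]
  have hN0 : 0 < N := by linarith
  have h1 := abs_le.mp (h N (by linarith))
  have h2 : C / N ^ 2 ≤ 1 / 4 / N := by
    rw [div_div, div_le_div_iff₀ (by positivity) (by positivity)]; nlinarith
  have h3 : (1 / 4) / N ≤ 1 / 4 := by
    rw [div_le_iff₀ hN0]; linarith
  have h4 : (2 * τ + 1) / N ≤ 1 / 4 := by
    rw [div_le_iff₀ hN0]; linarith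
  have h5 : 3 / N ≤ (2 * τ + 1) / N := by gcongr; linarith
  have h6 : 5 / 2 / (m : ℝ) ≤ (11 / 4) / N := by
    rw [div_le_div_iff₀ hm0 hN0]; linarith
  have h7 : 3 / N - 1 / 4 / N = (11 / 4) / N := by ring
  exact ⟨by linarith, by linarith⟩

theorem exists_dominant (α β γ : ℝ) {τ : ℕ} (hτ : 1 ≤ τ) :
    ∃ z : ℕ → ℝ, ∃ l ≠ 0, Tendsto z atTop (𝓝 l) ∧
      IsSol α β γ τ fun m => growth τ m * z m := by
  obtain ⟨C, hC⟩ := exists_abs_normE_le α β γ hτ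
  obtain ⟨z, l, hl, hz, h⟩ := exists_recurrence_tendsto_ne_zero
    (b := fun m => normB α β γ τ ((m : ℝ) + 1 / 2)) (η := fun m => normE α β γ τ ((m : ℝ) + 1 / 2))
    (C := C)
    ((eventually_normB_bounds α β γ hτ).mono fun m h => ⟨h.1.le, h.2⟩) (by
      have hC0 : 0 ≤ C := by simpa using (abs_nonneg _).trans (hC 1 le_rfl)
      filter_upwards [eventually_ge_atTop 1] with m hm
      have hm1 : (1 : ℝ) ≤ m := by exact_mod_cast hm
      refine (hC _ (by linarith)).trans ?_
      gcongr
      linarith)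
  refine ⟨z, l, hl, hz, ?_⟩
  filter_upwards [h] with m hm
  have e : ((m + 1 : ℕ) : ℝ) + 1 / 2 = (m : ℝ) + 1 / 2 + 1 := by push_cast; ring
  have e' : (m : ℝ) + 3 / 2 = (m : ℝ) + 1 / 2 + 1 := by ring
  rw [show m + 2 = m + 1 + 1 from rfl, growth_succ, growth_succ, e, e']
  have g0 := growthRatio_pos hτ (by positivity : 0 < (m : ℝ) + 1 / 2)
  have g1 := growthRatio_pos hτ (by positivity : 0 < (m : ℝ) + 1 / 2 + 1)
  have hz2 : z (m + 1 + 1) = recA α β γ τ ((m : ℝ) + 1 / 2 + 1) /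
      growthRatio τ ((m : ℝ) + 1 / 2 + 1) * z (m + 1)
      - normB α β γ τ ((m : ℝ) + 1 / 2) * z m := by
    rw [normE] at hm
    linear_combination hm
  rw [hz2, normB]
  generalize growthRatio τ ((m : ℝ) + 1 / 2) = r, growthRatio τ ((m : ℝ) + 1 / 2 + 1) = s at *
  field_simp
  ring

theorem tendsto_nat_add_half : Tendsto (fun m : ℕ => (m : ℝ) + 1 / 2) atTop atTop :=
  tendsto_atTop_add_const_right _ _ tendsto_natCast_atTop_atTop

theorem tendsto_one_add_inv_pow (k : ℕ) :
    Tendsto (fun m : ℕ => (1 + 1 / ((m : ℝ) + 1 / 2)) ^ k) atTop (𝓝 1) := by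
  have := ((tendsto_nat_add_half.inv_tendsto_atTop).const_add 1).pow k
  simpa using this

theorem tendsto_mul_one_add_inv_pow_sub_one (k : ℕ) :
    Tendsto (fun m : ℕ => ((m : ℝ) + 1 / 2) * ((1 + 1 / ((m : ℝ) + 1 / 2)) ^ k - 1))
      atTop (𝓝 k) := by
  obtain ⟨C, hC, h⟩ := exists_abs_one_add_pow_sub_le k
  rw [tendsto_iff_norm_sub_tendsto_zero]
  have h0 : Tendsto (fun m : ℕ => C * ((m : ℝ) + 1 / 2)⁻¹) atTop (𝓝 0) := by
    simpa using (tendsto_nat_add_half.inv_tendsto_atTop).const_mul C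
  refine squeeze_zero' (Eventually.of_forall fun _ => norm_nonneg _) ?_ h0
  filter_upwards [eventually_ge_atTop 1] with m hm
  have hm1 : (1 : ℝ) ≤ m := by exact_mod_cast hm
  obtain ⟨N, hN⟩ : ∃ N : ℝ, N = (m : ℝ) + 1 / 2 := ⟨_, rfl⟩
  rw [← hN]
  have hN0 : 0 < N := by linarith
  have h1 := h (1 / N) (by positivity) (by rw [div_le_one hN0]; linarith)
  have e : N * ((1 + 1 / N) ^ k - 1) - k = N * ((1 + 1 / N) ^ k - 1 - k * (1 / N)) := by
    field_simp
  rw [Real.norm_eq_abs, e, abs_mul, abs_of_pos hN0]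
  calc _ ≤ N * (C * (1 / N) ^ 2) := by gcongr
    _ = _ := by field_simp

/-- The power is chosen to cancel the `1/N` term of `normB`: the ratios of consecutive terms become
`1 + O(N⁻²)` and their product converges. -/
theorem exists_tendsto_casoratian_growth (α β γ : ℝ) {τ : ℕ} (hτ : 1 ≤ τ) {U : ℕ → ℝ}
    (hU : ∀ᶠ m : ℕ in atTop, U (m + 1) = normB α β γ τ ((m : ℝ) + 1 / 2) * U m)
    (hU0 : ∀ m, U m ≠ 0) :
    ∃ c ≠ 0, Tendsto (fun m : ℕ => U m * ((m : ℝ) + 1 / 2) ^ (2 * τ + 1)) atTop (𝓝 c) := by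
  obtain ⟨C₁, hC₁, h₁⟩ := exists_abs_normB_le α β γ hτ
  obtain ⟨C₂, hC₂, h₂⟩ := exists_abs_one_add_pow_sub_le (2 * τ + 1)
  obtain ⟨κ, hκ⟩ : ∃ κ : ℝ, κ = 2 * τ + 1 := ⟨_, rfl⟩
  have hκ0 : 0 ≤ κ := by rw [hκ]; positivity
  obtain ⟨C, hC⟩ : ∃ C, C = C₁ * 2 ^ (2 * τ + 1) + (1 + κ) * C₂ + κ ^ 2 := ⟨_, rfl⟩
  have hC0 : 0 ≤ C := by rw [hC]; positivity
  refine exists_tendsto_ne_zero_of_ratio (ε := fun m : ℕ => normB α β γ τ ((m : ℝ) + 1 / 2) *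
    (1 + 1 / ((m : ℝ) + 1 / 2)) ^ (2 * τ + 1) - 1) ?_ ?_ ?_
  · have hsum : Summable fun m : ℕ => C / (m : ℝ) ^ 2 := by
      simpa [div_eq_mul_inv] using (Real.summable_nat_pow_inv.mpr one_lt_two).mul_left C
    refine Summable.of_norm_bounded_eventually_nat hsum ?_
    filter_upwards [eventually_ge_atTop 1] with m hm
    have hm1 : (1 : ℝ) ≤ m := by exact_mod_cast hm
    obtain ⟨N, hN⟩ : ∃ N : ℝ, N = (m : ℝ) + 1 / 2 := ⟨_, rfl⟩
    rw [← hN]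
    have hN1 : 1 ≤ N := by linarith
    have hN0 : 0 < N := by linarith
    have i0 : 0 ≤ 1 / N := by positivity
    have i1 : 1 / N ≤ 1 := by rw [div_le_one hN0]; exact hN1
    have a1 := h₁ N hN1
    have a2 := h₂ (1 / N) i0 i1
    have e2 : ((2 * τ + 1 : ℕ) : ℝ) * (1 / N) = κ / N := by rw [hκ]; push_cast; ring
    rw [e2] at a2
    rw [← hκ] at a1
    generalize normB α β γ τ N = b at *
    have a3 : (1 + 1 / N) ^ (2 * τ + 1) ≤ 2 ^ (2 * τ + 1) := by
      gcongr; linarith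
    have a3' : 0 ≤ (1 + 1 / N) ^ (2 * τ + 1) := by positivity
    generalize (1 + 1 / N) ^ (2 * τ + 1) = P at *
    have a4 : |1 - κ / N| ≤ 1 + κ := by
      have : κ / N ≤ κ := div_le_self hκ0 hN1
      have : 0 ≤ κ / N := by positivity
      exact abs_le.mpr ⟨by linarith, by linarith⟩
    have e : b * P - 1 = (b - (1 - κ / N)) * P + (1 - κ / N) * (P - 1 - κ / N)
        + -(κ ^ 2 / N ^ 2) := by field_simp; ring
    rw [Real.norm_eq_abs, e]
    calc _ ≤ |(b - (1 - κ / N)) * P| + |(1 - κ / N) * (P - 1 - κ / N)| + |-(κ ^ 2 / N ^ 2)| :=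
          abs_add_three _ _ _
      _ = |b - (1 - κ / N)| * P + |1 - κ / N| * |P - 1 - κ / N| + κ ^ 2 / N ^ 2 := by
          rw [abs_mul, abs_mul, abs_neg, abs_of_nonneg a3',
            abs_of_nonneg (by positivity : 0 ≤ κ ^ 2 / N ^ 2)]
      _ ≤ C₁ / N ^ 2 * 2 ^ (2 * τ + 1) + (1 + κ) * (C₂ * (1 / N) ^ 2) + κ ^ 2 / N ^ 2 := by
          gcongr
      _ = C / N ^ 2 := by rw [hC]; field_simp
      _ ≤ C / (m : ℝ) ^ 2 := by gcongr; linarith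
  · filter_upwards [hU] with m hm
    have : (0 : ℝ) < (m : ℝ) + 1 / 2 := by positivity
    have e : ((m + 1 : ℕ) : ℝ) + 1 / 2 = (1 + 1 / ((m : ℝ) + 1 / 2)) * ((m : ℝ) + 1 / 2) := by
      field_simp; push_cast; ring
    rw [hm, e, mul_pow]
    ring
  · exact Eventually.of_forall fun m => mul_ne_zero (hU0 m) (by positivity)

/-- The solutions of the recurrence are eventually the combinations of a dominant solution `D` of
growth `growth τ` and of `D * T`, where `T m` is asymptotic to a multiple of `m ^ (-2 * τ)`. -/
theorem exists_basis (α β γ : ℝ) {τ : ℕ} (hτ : 1 ≤ τ) :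
    ∃ D T : ℕ → ℝ, ∃ l ≠ 0, ∃ c ≠ 0, Tendsto (fun m => D m / growth τ m) atTop (𝓝 l) ∧
      Tendsto (fun m : ℕ => T m * (m : ℝ) ^ (2 * τ)) atTop (𝓝 c) ∧
      ∀ Y, IsSol α β γ τ Y → ∃ a b : ℝ, ∀ᶠ m in atTop, Y m = D m * (a + b * T m) := by
  obtain ⟨z, l, hl, hz, hD⟩ := exists_dominant α β γ hτ
  obtain ⟨D, hDdef⟩ : ∃ D : ℕ → ℝ, D = fun m => growth τ m * z m := ⟨_, rfl⟩
  rw [← hDdef] at hD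
  have hz0 : ∀ᶠ m in atTop, z m ≠ 0 := hz.eventually_ne hl
  have hD0 : ∀ᶠ m in atTop, D m ≠ 0 := by
    filter_upwards [hz0] with m hm
    rw [hDdef]; exact mul_ne_zero (growth_pos hτ m).ne' hm
  -- `-recB` is positive only for large `j`. Replacing its other values by `1` makes the Casoratian
  -- model `W` positive everywhere and changes only finitely many factors.
  let q : ℕ → ℝ := fun j =>
    if recB α β γ ((j : ℝ) + 1 / 2) < 0 then -recB α β γ ((j : ℝ) + 1 / 2) else 1
  have hq : ∀ j, 0 < q j := fun j => by
    simp only [q]; split_ifs with h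
    · linarith
    · exact one_pos
  have hq' : ∀ᶠ j : ℕ in atTop, q j = -recB α β γ ((j : ℝ) + 1 / 2) := by
    filter_upwards [eventually_normB_bounds α β γ hτ] with j hj
    have g0 := growthRatio_pos hτ (by positivity : 0 < (j : ℝ) + 1 / 2)
    have g1 := growthRatio_pos hτ (by positivity : 0 < (j : ℝ) + 1 / 2 + 1)
    have : 0 < -recB α β γ ((j : ℝ) + 1 / 2) :=
      (div_pos_iff_of_pos_right (mul_pos g0 g1)).mp hj.1
    exact if_pos (by linarith)
  let W : ℕ → ℝ := fun m => ∏ j ∈ Finset.range m, q j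
  have hW0 : ∀ m, 0 < W m := fun m => Finset.prod_pos fun j _ => hq j
  have hW : ∀ᶠ m : ℕ in atTop, W (m + 1) = -recB α β γ ((m : ℝ) + 1 / 2) * W m := by
    filter_upwards [hq'] with m hm
    simp only [W]
    rw [Finset.prod_range_succ, hm, mul_comm]
  obtain ⟨c, hc, hcU⟩ := exists_tendsto_casoratian_growth α β γ hτ
    (U := fun m => W m / (growth τ m * growth τ (m + 1))) (by
      filter_upwards [hW] with m hm
      have e : ((m + 1 : ℕ) : ℝ) + 1 / 2 = (m : ℝ) + 1 / 2 + 1 := by push_cast; ring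
      have g0 := growthRatio_pos hτ (by positivity : 0 < (m : ℝ) + 1 / 2)
      have g1 := growthRatio_pos hτ (by positivity : 0 < (m : ℝ) + 1 / 2 + 1)
      have g := growth_pos hτ m
      rw [hm, normB, growth_succ τ (m + 1), growth_succ τ m, e]
      field_simp)
    (fun m => (div_pos (hW0 m) (mul_pos (growth_pos hτ m) (growth_pos hτ (m + 1)))).ne')
  let v : ℕ → ℝ := fun m => (((m : ℝ) + 1 / 2) ^ (2 * τ))⁻¹
  have hτ0 : (2 * (τ : ℝ)) ≠ 0 := by
    have : (1 : ℝ) ≤ τ := by exact_mod_cast hτ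
    linarith
  have hv : Tendsto (fun m : ℕ => ((m : ℝ) + 1 / 2) ^ (2 * τ + 1) * (v m - v (m + 1)))
      atTop (𝓝 (2 * τ)) := by
    have := (tendsto_mul_one_add_inv_pow_sub_one (2 * τ)).div (tendsto_one_add_inv_pow (2 * τ))
      one_ne_zero
    push_cast at this
    rw [div_one] at this
    refine this.congr fun m => ?_
    obtain ⟨N, hN⟩ : ∃ N : ℝ, N = (m : ℝ) + 1 / 2 := ⟨_, rfl⟩
    have hN0 : 0 < N := by rw [hN]; positivity
    have e : ((m + 1 : ℕ) : ℝ) + 1 / 2 = (1 + 1 / N) * N := by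
      rw [hN]; field_simp; push_cast; ring
    simp only [v, Pi.div_apply]
    rw [e, ← hN, mul_pow, pow_succ]
    have : 0 < (1 + 1 / N) ^ (2 * τ) := by positivity
    generalize (1 + 1 / N) ^ (2 * τ) = P at *
    field_simp
  -- Reduction of order: `T` is the quotient of a second solution by `D`, so its differences are a
  -- Casoratian over `D m * D (m + 1)`, of order `N ^ (-(2τ+1))`.
  obtain ⟨T, hT, hTv⟩ := exists_antidifference_tendsto (V := fun m => W m / (D m * D (m + 1)))
    (v := v) (c := c / (l * l) / (2 * τ))
    (fun m => by
      simp only [v]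
      gcongr
      · linarith)
    ((tendsto_pow_atTop (by omega)).comp tendsto_nat_add_half).inv_tendsto_atTop (by
      have := (hcU.div (hz.mul ((tendsto_add_atTop_iff_nat 1).mpr hz)) (mul_ne_zero hl hl)).div hv
        hτ0
      refine this.congr fun m => ?_
      have g := growth_pos hτ m
      have g' := growth_pos hτ (m + 1)
      have hN : (0 : ℝ) < ((m : ℝ) + 1 / 2) ^ (2 * τ + 1) := by positivity
      simp only [Pi.div_apply, hDdef]
      generalize ((m : ℝ) + 1 / 2) ^ (2 * τ + 1) = P at *
      simp only [div_mul_eq_mul_div, div_div]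
      rw [mul_comm (W m) P,
        show growth τ m * growth τ (m + 1) * (z m * z (m + 1)) * (P * (v m - v (m + 1))) =
          P * (growth τ m * z m * (growth τ (m + 1) * z (m + 1)) * (v m - v (m + 1))) by ring,
        mul_div_mul_left _ _ hN.ne'])
  refine ⟨D, T, l, hl, -(c / (l * l) / (2 * τ)), ?_, ?_, ?_, ?_⟩
  · exact neg_ne_zero.mpr (div_ne_zero (div_ne_zero hc (mul_ne_zero hl hl)) hτ0)
  · refine hz.congr fun m => ?_
    rw [hDdef]
    exact (mul_div_cancel_left₀ _ (growth_pos hτ m).ne').symm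
  · have h1 : Tendsto (fun m : ℕ => ((m : ℝ) / ((m : ℝ) + 1 / 2)) ^ (2 * τ)) atTop (𝓝 1) := by
      simpa using (tendsto_natCast_div_add_atTop (1 / 2 : ℝ)).pow (2 * τ)
    have := hTv.mul h1
    rw [mul_one] at this
    refine this.congr fun m => ?_
    have : (0 : ℝ) < (m : ℝ) + 1 / 2 := by positivity
    simp only [v]
    rw [div_pow]
    field_simp
  · intro Y hY
    -- The Casoratian of `Y` with `D` obeys the recurrence of `W`, so it is eventually `b * W`; then
    -- `Y / D` and `b * T` have the same differences.
    obtain ⟨b, hb⟩ := exists_eventually_eq_of_eventually_succ_eq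
      (f := fun m => casoratian Y D m / W m) (by
        filter_upwards [casoratian_succ hY hD, hW, hq'] with m h1 h2 h3
        have h4 := hq m
        rw [h1, h2, ← h3, mul_div_mul_left _ _ h4.ne'])
    obtain ⟨a, ha⟩ := exists_eventually_eq_of_eventually_succ_eq
      (f := fun m => Y m / D m - b * T m) (by
        filter_upwards [hb, hD0, (tendsto_add_atTop_nat 1).eventually hD0] with m h1 h2 h3
        have h4 : T (m + 1) = T m + W m / (D m * D (m + 1)) := by rw [← hT]; ring
        have h5 : casoratian Y D m = b * W m := by
          rw [← h1, div_mul_cancel₀ _ (hW0 m).ne']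
        rw [casoratian] at h5
        rw [h4]
        field_simp
        linear_combination h5)
    refine ⟨a, b, ?_⟩
    filter_upwards [ha, hD0] with m h1 h2
    rw [← h1]
    field_simp
    ring

end Basis

/-! ### Rational approximating pairs for `ζ(3)`, carried through the shifts. -/

section Pairs

theorem IsSol.sub_mul {K : Type*} [Field K] {α β γ τ : K} {x y : ℕ → K}
    (hx : IsSol α β γ τ x) (hy : IsSol α β γ τ y) (z : K) :
    IsSol α β γ τ fun m => x m - z * y m := by
  filter_upwards [hx, hy] with m h1 h2
  rw [h1, h2]; ring

theorem IsSol.ratCast {α β γ τ : ℚ} {x : ℕ → ℚ} (hx : IsSol α β γ τ x) :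
    IsSol (α : ℝ) β γ τ fun m => (x m : ℝ) := by
  filter_upwards [hx] with m hm
  rw [hm]; simp only [recA, recB]; push_cast; rfl

theorem casoratian_combination {D T Y Z : ℕ → ℝ} {a b c d : ℝ} {m : ℕ}
    (hY : Y m = D m * (a + b * T m)) (hY' : Y (m + 1) = D (m + 1) * (a + b * T (m + 1)))
    (hZ : Z m = D m * (c + d * T m)) (hZ' : Z (m + 1) = D (m + 1) * (c + d * T (m + 1))) :
    casoratian Y Z m = (a * d - b * c) * (D m * D (m + 1) * (T m - T (m + 1))) := by
  rw [casoratian, hY, hY', hZ, hZ']; ring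

theorem det_ne_zero_of_casoratian {D T Y Z : ℕ → ℝ} {a b c d : ℝ}
    (hY : ∀ᶠ m in atTop, Y m = D m * (a + b * T m))
    (hZ : ∀ᶠ m in atTop, Z m = D m * (c + d * T m))
    (h : ∀ᶠ m in atTop, casoratian Y Z m ≠ 0) : a * d - b * c ≠ 0 := by
  obtain ⟨m, h1, h2, h3, h4, h5⟩ := (hY.and (hZ.and (h.and
    (((tendsto_add_atTop_nat 1).eventually hY).and
      ((tendsto_add_atTop_nat 1).eventually hZ))))).exists
  intro h0
  rw [casoratian_combination h1 h4 h2 h5, h0, zero_mul] at h3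
  exact h3 rfl

theorem tendsto_zero_of_tendsto_mul_pow {T : ℕ → ℝ} {c : ℝ} {k : ℕ} (hk : k ≠ 0)
    (h : Tendsto (fun m : ℕ => T m * (m : ℝ) ^ k) atTop (𝓝 c)) : Tendsto T atTop (𝓝 0) := by
  have h1 : Tendsto (fun m : ℕ => ((m : ℝ) ^ k)⁻¹) atTop (𝓝 0) :=
    ((tendsto_pow_atTop hk).comp tendsto_natCast_atTop_atTop).inv_tendsto_atTop
  have := h.mul h1
  rw [mul_zero] at this
  refine this.congr' ?_
  filter_upwards [eventually_ge_atTop 1] with m hm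
  have : (0 : ℝ) < m := by exact_mod_cast hm
  field_simp

theorem tendsto_mul_zero_of_tendsto_mul_pow {T : ℕ → ℝ} {c : ℝ} {k : ℕ} (hk : 2 ≤ k)
    (h : Tendsto (fun m : ℕ => T m * (m : ℝ) ^ k) atTop (𝓝 c)) :
    Tendsto (fun m : ℕ => T m * m) atTop (𝓝 0) := by
  refine tendsto_zero_of_tendsto_mul_pow (k := k - 1) (c := c) (by omega) (h.congr fun m => ?_)
  rw [mul_assoc, ← pow_succ', Nat.sub_add_cancel (by omega)]

/-- A solution which is negligible with respect to the growth of the dominant solutions is a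
multiple of the minimal solution, and hence much smaller. -/
theorem IsSol.tendsto_mul_of_tendsto_zero {α β γ : ℝ} {τ : ℕ} (hτ : 1 ≤ τ) {e : ℕ → ℝ}
    (he : IsSol α β γ τ e) (h : Tendsto (fun m => e m / growth τ m) atTop (𝓝 0)) :
    Tendsto (fun m : ℕ => e m / growth τ m * m) atTop (𝓝 0) := by
  obtain ⟨D, T, l, hl, c, hc, hD, hT, hY⟩ := exists_basis α β γ hτ
  obtain ⟨a, b, hab⟩ := hY e he
  have hT0 := tendsto_zero_of_tendsto_mul_pow (by omega) hT
  have ha : a = 0 := by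
    have h1 : Tendsto (fun m => D m / growth τ m * (a + b * T m)) atTop (𝓝 (l * (a + b * 0))) :=
      hD.mul ((hT0.const_mul b).const_add a)
    have h2 := tendsto_nhds_unique (h1.congr' (by
      filter_upwards [hab] with m hm
      rw [hm]; ring)) h
    simpa [hl] using h2
  have h1 := hD.mul ((tendsto_mul_zero_of_tendsto_mul_pow (by omega) hT).const_mul b)
  simp only [mul_zero] at h1
  refine h1.congr' ?_
  filter_upwards [hab] with m hm
  rw [hm, ha]; ring

/-- The quotient of the two products telescopes. -/
theorem growth_succ_parameter (τ m : ℕ) :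
    growth (τ + 1) m * ((τ : ℝ) - 1 / 2) = growth τ m * ((m : ℝ) + τ - 1 / 2) := by
  induction m with
  | zero => simp [growth]
  | succ m ih =>
    rw [growth_succ, growth_succ]
    simp only [growthRatio]
    push_cast
    linear_combination ((m : ℝ) + 1 / 2) ^ 2 * ((m : ℝ) + τ + 1 / 2) * ih

/-- The operator costs order `N⁵` relative to `growth τ m`, while `growth (τ + 1) (m + 1)` gains
only `N⁴`. The missing factor `N` comes from `IsSol.tendsto_mul_of_tendsto_zero`. -/
theorem tendsto_shiftSol_div_growth {α β γ : ℝ} {τ : ℕ} (hτ : 1 ≤ τ) {e : ℕ → ℝ}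
    (he : IsSol α β γ τ e) (h : Tendsto (fun m => e m / growth τ m) atTop (𝓝 0)) :
    Tendsto (fun m => shiftSol α β γ τ e m / growth (τ + 1) m) atTop (𝓝 0) := by
  have h1 := he.tendsto_mul_of_tendsto_zero hτ h
  have hτ' : (1 : ℝ) ≤ τ := by exact_mod_cast hτ
  obtain ⟨ρ, hρ⟩ : ∃ ρ : ℕ → ℝ, ρ = fun m => e m / growth τ m := ⟨_, rfl⟩
  have h2 : Tendsto (fun m : ℕ => ((m : ℝ) + 1 / 2) * ρ m) atTop (𝓝 0) := by
    have := h1.add (h.const_mul (1 / 2))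
    rw [mul_zero, add_zero] at this
    refine this.congr fun m => ?_
    rw [hρ]; ring
  have h3 : Tendsto (fun m : ℕ => ((m : ℝ) + 1 / 2) * ρ (m + 1)) atTop (𝓝 0) := by
    have := (h1.sub (h.const_mul (1 / 2))).comp (tendsto_add_atTop_nat 1)
    rw [mul_zero, sub_zero] at this
    refine this.congr fun m => ?_
    simp only [Function.comp, hρ]
    push_cast; ring
  have hi : Tendsto (fun m : ℕ => ((m : ℝ) + 1 / 2)⁻¹) atTop (𝓝 0) :=
    tendsto_nat_add_half.inv_tendsto_atTop
  have hφ : ∀ φ : ℝ → ℝ, ContinuousAt φ 0 →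
      Tendsto (fun m : ℕ => φ ((m : ℝ) + 1 / 2)⁻¹) atTop (𝓝 (φ 0)) := fun φ h => h.tendsto.comp hi
  -- The normalised coefficients are functions of `i = 1/N` continuous at `0`, hence have finite
  -- limits.
  have t1 := hφ (fun i => ((τ : ℝ) - 1 / 2) / (1 + τ * i)) (by fun_prop (disch := norm_num))
  have t2 := hφ (fun i => -(1 + (α + τ + 1) * i
    + ((α + τ + 1) ^ 2 - β ^ 2 - γ ^ 2) / 2 * i ^ 2)) (by fun_prop)
  have t3 := hφ (fun i => (1 + α * i) * (1 - β ^ 2 * i ^ 2) * (1 - γ ^ 2 * i ^ 2) /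
    (1 + (τ - 1) * i)) (by fun_prop (disch := norm_num))
  have := t1.mul ((t2.mul h3).add (t3.mul h2))
  simp only [mul_zero, add_zero] at this
  refine (tendsto_add_atTop_iff_nat 1).mp (this.congr fun m => ?_)
  have g0 := growth_pos hτ m
  have g1 := growth_pos (show 1 ≤ τ + 1 by omega) (m + 1)
  have k1 := growth_succ_parameter τ (m + 1)
  rw [growth_succ τ] at k1
  rw [shiftSol_succ]
  simp only [hρ, growth_succ τ]
  have r0 := growthRatio_pos hτ (by positivity : 0 < (m : ℝ) + 1 / 2)
  obtain ⟨N, hN⟩ : ∃ N : ℝ, N = (m : ℝ) + 1 / 2 := ⟨_, rfl⟩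
  have hN0 : 0 < N := by rw [hN]; positivity
  have e1 : ((m + 1 : ℕ) : ℝ) + τ - 1 / 2 = N + τ := by rw [hN]; push_cast; ring
  rw [e1] at k1
  rw [← hN] at k1 r0 ⊢
  have hNτ : 0 < N + τ := by linarith
  have hNτ' : 0 < N + τ - 1 := by linarith
  have k2 : growth (τ + 1) (m + 1) =
      growth τ m * growthRatio τ N * (N + τ) / ((τ : ℝ) - 1 / 2) := by
    rw [eq_div_iff (by linarith), k1]
  have i1 : 1 + (τ : ℝ) * N⁻¹ = (N + τ) / N := by field_simp
  have i2 : 1 + ((τ : ℝ) - 1) * N⁻¹ = (N + τ - 1) / N := by field_simp; ring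
  have hτ2 : (τ : ℝ) - 1 / 2 ≠ 0 := by linarith
  rw [k2, i1, i2]
  simp only [shiftF, shiftG, growthRatio]
  generalize growth τ m = g at *
  generalize (τ : ℝ) - 1 / 2 = t at *
  field_simp

/-- There are two independent rational solutions `P, Q` of the recurrence such that `P - z * Q` is
negligible with respect to the dominant solutions. -/
def HasRationalPair (z : ℝ) (α β γ : ℚ) (τ : ℕ) : Prop :=
  ∃ P Q : ℕ → ℚ, IsSol α β γ (τ : ℚ) P ∧ IsSol α β γ (τ : ℚ) Q ∧
    (∀ᶠ m in atTop, casoratian P Q m ≠ 0) ∧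
    Tendsto (fun m => ((P m : ℝ) - z * Q m) / growth τ m) atTop (𝓝 0)

theorem HasRationalPair.swap {z : ℝ} {α β γ : ℚ} {τ : ℕ} (h : HasRationalPair z α β γ τ) :
    HasRationalPair z β α γ τ := by
  obtain ⟨P, Q, hP, hQ, h⟩ := h
  exact ⟨P, Q, hP.swap, hQ.swap, h⟩

theorem HasRationalPair.rotate {z : ℝ} {α β γ : ℚ} {τ : ℕ} (h : HasRationalPair z α β γ τ) :
    HasRationalPair z β γ α τ := by
  obtain ⟨P, Q, hP, hQ, h⟩ := h
  exact ⟨P, Q, hP.rotate, hQ.rotate, h⟩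

theorem HasRationalPair.neg {z : ℝ} {α β γ : ℚ} {τ : ℕ} (h : HasRationalPair z α β γ τ) :
    HasRationalPair z (-α) β γ τ := by
  obtain ⟨P, Q, hP, hQ, h⟩ := h
  exact ⟨P, Q, hP.neg, hQ.neg, h⟩

/-- The two inequalities say that the constant in `casoratian_shiftSol` is nonzero, so independence
is preserved. -/
theorem HasRationalPair.shift {z : ℝ} {α β γ : ℚ} {τ : ℕ} (h : HasRationalPair z α β γ τ)
    (hτ : 1 ≤ τ) (h₁ : (α + τ + 1) ^ 2 ≠ (β - γ) ^ 2) (h₂ : (α + τ + 1) ^ 2 ≠ (β + γ) ^ 2) :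
    HasRationalPair z (α + 1) β γ (τ + 1) := by
  obtain ⟨P, Q, hP, hQ, hW, hlim⟩ := h
  refine ⟨shiftSol α β γ τ P, shiftSol α β γ τ Q, by exact_mod_cast hP.shift,
    by exact_mod_cast hQ.shift, ?_, ?_⟩
  · rw [← map_add_atTop_eq_nat 1, eventually_map]
    have hm : ∀ᶠ m : ℕ in atTop, -α < (m : ℚ) :=
      tendsto_natCast_atTop_atTop.eventually_gt_atTop _
    filter_upwards [hP, hQ, (tendsto_add_atTop_nat 1).eventually hW, hm] with m h1 h2 h3 h4
    intro h0
    have h5 := casoratian_shiftSol h1 h2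
    rw [h0, mul_zero] at h5
    have h6 : (m : ℚ) + 3 / 2 + α ≠ 0 := by linarith
    exact mul_ne_zero (mul_ne_zero (div_ne_zero (mul_ne_zero (neg_ne_zero.mpr (sub_ne_zero.mpr h₁))
      (sub_ne_zero.mpr h₂)) (by norm_num)) h6) h3 h5.symm
  · have he : IsSol (α : ℝ) β γ τ fun m => (P m : ℝ) - z * Q m :=
      IsSol.sub_mul (by exact_mod_cast hP.ratCast) (by exact_mod_cast hQ.ratCast) z
    refine (tendsto_shiftSol_div_growth hτ he hlim).congr fun m => ?_
    congr 1
    simp only [shiftSol, shiftF, shiftG]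
    push_cast
    ring

theorem hasSum_zetaThree : HasSum (fun n : ℕ => 1 / (n : ℝ) ^ 3) zetaThree := by
  have h : Summable fun n : ℕ => 1 / (n : ℝ) ^ 3 := Real.summable_one_div_nat_pow.mpr (by norm_num)
  have h1 : zetaThree = ∑' n : ℕ, 1 / (n : ℝ) ^ 3 := by
    have h2 := zeta_nat_eq_tsum_of_gt_one (k := 3) (by norm_num)
    have h3 := coe_zetaThree
    refine Complex.ofReal_injective ?_
    push_cast at h2 ⊢
    rw [h3, h2]
  rw [h1]
  exact h.hasSum

theorem hasSum_half_integers : HasSum (fun n : ℕ => 1 / ((n : ℝ) + 1 / 2) ^ 3) (7 * zetaThree) := by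
  have h0 := hasSum_zetaThree
  have he : HasSum (fun n : ℕ => 1 / ((2 * n : ℕ) : ℝ) ^ 3) (zetaThree / 8) := by
    have e : (fun n : ℕ => 1 / ((2 * n : ℕ) : ℝ) ^ 3) = fun n : ℕ => 1 / (n : ℝ) ^ 3 / 8 := by
      funext n
      rw [div_div, Nat.cast_mul, mul_pow, mul_comm]
      norm_num
    rw [e]
    exact h0.div_const 8
  obtain ⟨t, ht⟩ : Summable fun n : ℕ => 1 / ((2 * n + 1 : ℕ) : ℝ) ^ 3 :=
    Summable.comp_injective (f := fun n : ℕ => 1 / (n : ℝ) ^ 3) h0.summable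
      (i := fun n : ℕ => 2 * n + 1) fun a b h => by simpa using h
  have h1 := (HasSum.even_add_odd (f := fun n : ℕ => 1 / (n : ℝ) ^ 3) he ht).unique h0
  have h2 := ht.mul_left 8
  rw [show 8 * t = 7 * zetaThree by linarith] at h2
  have e : (fun n : ℕ => 1 / ((n : ℝ) + 1 / 2) ^ 3) =
      fun n : ℕ => 8 * (1 / ((2 * n + 1 : ℕ) : ℝ) ^ 3) := by
    funext n
    rw [show ((2 * n + 1 : ℕ) : ℝ) = 2 * ((n : ℝ) + 1 / 2) by push_cast; ring, mul_pow]
    have : (n : ℝ) + 1 / 2 ≠ 0 := by positivity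
    field_simp
    norm_num
  rwa [e]

/-- Here `recA = N³ + (N-1)³` and `recB = -N⁶`, and `growth 1` is `Q` itself. Division by `7`
normalises the limit of the sums to `ζ(3)`. -/
theorem hasRationalPair_base : HasRationalPair zetaThree 0 0 0 1 := by
  let Q : ℕ → ℚ := fun m => ∏ j ∈ Finset.range m, ((j : ℚ) + 1 / 2) ^ 3
  let S : ℕ → ℚ := fun m => ∑ j ∈ Finset.range m, 1 / ((j : ℚ) + 1 / 2) ^ 3
  have hQ : ∀ m, Q (m + 1) = Q m * ((m : ℚ) + 1 / 2) ^ 3 := fun m => Finset.prod_range_succ _ _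
  have hS : ∀ m, S (m + 1) = S m + 1 / ((m : ℚ) + 1 / 2) ^ 3 := fun m => Finset.sum_range_succ _ _
  have hQ0 : ∀ m, Q m ≠ 0 := fun m => Finset.prod_ne_zero_iff.mpr fun j _ => by positivity
  refine ⟨fun m => Q m * S m / 7, Q, ?_, ?_, ?_, ?_⟩
  · refine Eventually.of_forall fun m => ?_
    have h0 : (m : ℚ) + 1 / 2 ≠ 0 := by positivity
    have h1 : (m : ℚ) + 1 + 1 / 2 ≠ 0 := by positivity
    simp only [show m + 2 = m + 1 + 1 from rfl, hQ, hS, recA, recB]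
    push_cast
    field_simp
    ring
  · refine Eventually.of_forall fun m => ?_
    simp only [show m + 2 = m + 1 + 1 from rfl, hQ, recA, recB]
    push_cast
    ring
  · refine Eventually.of_forall fun m => ?_
    have h0 : (m : ℚ) + 1 / 2 ≠ 0 := by positivity
    have : casoratian (fun m => Q m * S m / 7) Q m = Q m ^ 2 / 7 := by
      simp only [casoratian, hQ, hS]
      field_simp
      ring
    rw [this]
    exact div_ne_zero (pow_ne_zero _ (hQ0 m)) (by norm_num)
  · have h1 : Tendsto (fun m => (S m : ℝ)) atTop (𝓝 (7 * zetaThree)) := by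
      refine hasSum_half_integers.tendsto_sum_nat.congr fun m => ?_
      simp only [S]; push_cast; rfl
    have h2 := (h1.div_const 7).sub_const zetaThree
    rw [show 7 * zetaThree / 7 - zetaThree = 0 by ring] at h2
    refine h2.congr fun m => ?_
    have h3 : growth 1 m = Q m := by
      simp only [growth, growthRatio, Q]; push_cast
      exact Finset.prod_congr rfl fun j _ => by ring
    have h4 : (Q m : ℝ) ≠ 0 := by exact_mod_cast hQ0 m
    rw [h3]
    push_cast
    field_simp

/-- Two shifts separated by a sign change, `0 → 1`, `1 → -1`, `-1 → 0`, raise `τ` by `2` and restore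
`α`. -/
theorem hasRationalPair_zero (k : ℕ) : HasRationalPair zetaThree 0 0 0 (2 * k + 1) := by
  induction k with
  | zero => exact hasRationalPair_base
  | succ k ih =>
    have h1 : HasRationalPair zetaThree (0 + 1) 0 0 (2 * k + 1 + 1) := by
      refine ih.shift (by omega) ?_ ?_ <;> · push_cast; simp; positivity
    have h2 : HasRationalPair zetaThree (-(0 + 1) + 1) 0 0 (2 * k + 1 + 1 + 1) := by
      refine h1.neg.shift (by omega) ?_ ?_ <;> · push_cast; ring_nf; positivity
    rw [show 2 * (k + 1) + 1 = 2 * k + 1 + 1 + 1 by ring]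
    simpa using h2

/-- Along these shifts `α + τ + 1 = 2α + β + γ + 2k + 2` exceeds `β + γ`, so no Casoratian factor
vanishes. -/
theorem HasRationalPair.add_nat {z : ℝ} {β γ k : ℕ}
    (h : HasRationalPair z 0 β γ (β + γ + 2 * k + 1)) (α : ℕ) :
    HasRationalPair z α β γ (α + β + γ + 2 * k + 1) := by
  induction α with
  | zero => simpa using h
  | succ α ih =>
    have := ih.shift (by omega) ?_ ?_
    · rw [show α + 1 + β + γ + 2 * k + 1 = α + β + γ + 2 * k + 1 + 1 by ring]
      exact_mod_cast this
    all_goals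
      push_cast
      refine ne_of_gt (sq_lt_sq' ?_ ?_)
      all_goals
        have : (0 : ℚ) ≤ α := by positivity
        have : (0 : ℚ) ≤ β := by positivity
        have : (0 : ℚ) ≤ γ := by positivity
        have : (0 : ℚ) ≤ k := by positivity
        linarith

theorem hasRationalPair (α β γ k : ℕ) :
    HasRationalPair zetaThree α β γ (α + β + γ + 2 * k + 1) := by
  have h1 : HasRationalPair zetaThree γ 0 0 (γ + 2 * k + 1) := by
    have := HasRationalPair.add_nat (β := 0) (γ := 0) (k := k)
      (by simpa using hasRationalPair_zero k) γ
    simpa using this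
  have h2 : HasRationalPair zetaThree β 0 γ (β + γ + 2 * k + 1) := by
    have := HasRationalPair.add_nat (β := 0) (γ := γ) (k := k) (by simpa using h1.rotate) β
    simpa using this
  exact HasRationalPair.add_nat h2.swap α

end Pairs

/-! ### From three-term recurrences to continued fractions with a prescribed tail. -/

section ContinuedFraction

theorem contFrac_nums_zero (a b : ℕ → ℚ) : (contFrac a b).nums 0 = a 0 := rfl

theorem contFrac_dens_zero (a b : ℕ → ℚ) : (contFrac a b).dens 0 = 1 := rfl

theorem contFrac_nums_one (a b : ℕ → ℚ) :
    (contFrac a b).nums 1 = (a 1 : ℝ) * a 0 + b 0 :=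
  GenContFract.first_num_eq (g := contFrac a b) (gp := ⟨(b 0 : ℝ), (a 1 : ℝ)⟩) rfl

theorem contFrac_dens_one (a b : ℕ → ℚ) : (contFrac a b).dens 1 = (a 1 : ℝ) :=
  GenContFract.first_den_eq (g := contFrac a b) (gp := ⟨(b 0 : ℝ), (a 1 : ℝ)⟩) rfl

theorem contFrac_nums_succ_succ (a b : ℕ → ℚ) (n : ℕ) :
    (contFrac a b).nums (n + 2) =
      (a (n + 2) : ℝ) * (contFrac a b).nums (n + 1) + b (n + 1) * (contFrac a b).nums n :=
  GenContFract.nums_recurrence (g := contFrac a b) (gp := ⟨(b (n + 1) : ℝ), (a (n + 2) : ℝ)⟩)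
    rfl rfl rfl

theorem contFrac_dens_succ_succ (a b : ℕ → ℚ) (n : ℕ) :
    (contFrac a b).dens (n + 2) =
      (a (n + 2) : ℝ) * (contFrac a b).dens (n + 1) + b (n + 1) * (contFrac a b).dens n :=
  GenContFract.dens_recurrence (g := contFrac a b) (gp := ⟨(b (n + 1) : ℝ), (a (n + 2) : ℝ)⟩)
    rfl rfl rfl

theorem contFrac_convs (a b : ℕ → ℚ) (n : ℕ) :
    (contFrac a b).convs n = (contFrac a b).nums n / (contFrac a b).dens n := rfl

theorem contFrac_det_ne_zero {a b : ℕ → ℚ} (hb : ∀ n, b n ≠ 0) (n : ℕ) :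
    casoratian (fun j => (contFrac a b).nums j) (fun j => (contFrac a b).dens j) n ≠ 0 := by
  induction n with
  | zero =>
    simp only [casoratian]
    rw [contFrac_nums_zero, contFrac_dens_zero, zero_add, contFrac_nums_one, contFrac_dens_one]
    have : (b 0 : ℝ) ≠ 0 := by exact_mod_cast hb 0
    convert this using 1
    ring
  | succ n ih =>
    have : casoratian (fun j => (contFrac a b).nums j) (fun j => (contFrac a b).dens j) (n + 1) =
        -(b (n + 1) : ℝ) *
          casoratian (fun j => (contFrac a b).nums j) (fun j => (contFrac a b).dens j) n := by
      simp only [casoratian]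
      rw [show n + 1 + 1 = n + 2 from rfl, contFrac_nums_succ_succ, contFrac_dens_succ_succ]
      ring
    rw [this]
    exact mul_ne_zero (neg_ne_zero.mpr (by exact_mod_cast hb (n + 1))) ih

/-- Two rational sequences that eventually satisfy the same three-term recurrence are, from some
index on, the numerators and denominators of a continued fraction with the given tail. -/
theorem exists_contFrac_of_recurrence {A B : ℕ → ℚ} {P Q : ℕ → ℚ} {k : ℕ} (hB : ∀ n, B n ≠ 0)
    (hP : ∀ n ≥ k, P (n + 2) = A (n + 2) * P (n + 1) + B (n + 1) * P n)
    (hQ : ∀ n ≥ k, Q (n + 2) = A (n + 2) * Q (n + 1) + B (n + 1) * Q n)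
    (hQ0 : ∀ n ≥ k, Q n ≠ 0) (hW : ∀ n ≥ k, casoratian P Q n ≠ 0) :
    ∃ a b : ℕ → ℚ, (∀ n, b n ≠ 0) ∧ (∀ᶠ n in atTop, a n = A n ∧ b n = B n) ∧
      ∀ᶠ n in atTop, (contFrac a b).nums n = P n ∧ (contFrac a b).dens n = Q n := by
  -- Padding with `a = 0`, `b = 1` makes (numerator, denominator) alternate between `(0, 1)` and
  -- `(1, 0)`. The odd index `s` ends on `(1, 0)`, after which two free steps prescribe both pairs
  -- `(P, Q)` at `s + 1` and `s + 2`.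
  obtain ⟨s, hs⟩ : ∃ s, s = 2 * k + 1 := ⟨_, rfl⟩
  have hks : k ≤ s + 1 := by omega
  let a : ℕ → ℚ := fun n => if n ≤ s then 0 else if n = s + 1 then P (s + 1) else
    if n = s + 2 then Q (s + 2) / Q (s + 1) else A n
  let b : ℕ → ℚ := fun n => if n < s then 1 else if n = s then Q (s + 1) else
    if n = s + 1 then casoratian P Q (s + 1) / Q (s + 1) else B n
  have a0 : ∀ n ≤ s, a n = 0 := fun n hn => if_pos hn
  have b0 : ∀ n < s, b n = 1 := fun n hn => if_pos hn
  have a1 : a (s + 1) = P (s + 1) := by simp [a]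
  have b1 : b s = Q (s + 1) := by simp [b]
  have a2 : a (s + 2) = Q (s + 2) / Q (s + 1) := by simp [a]
  have b2 : b (s + 1) = casoratian P Q (s + 1) / Q (s + 1) := by simp [b]
  have a3 : ∀ n ≥ s + 3, a n = A n := fun n hn => by
    simp only [a]; rw [if_neg (by omega), if_neg (by omega), if_neg (by omega)]
  have b3 : ∀ n ≥ s + 2, b n = B n := fun n hn => by
    simp only [b]; rw [if_neg (by omega), if_neg (by omega), if_neg (by omega)]
  have hq := hQ0 (s + 1) hks
  refine ⟨a, b, fun n => ?_, eventually_atTop.mpr ⟨s + 3, fun n hn => ⟨a3 n hn, b3 n (by omega)⟩⟩,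
    ?_⟩
  · rcases lt_or_ge n s with h | h
    · rw [b0 n h]; exact one_ne_zero
    rcases h.eq_or_lt with rfl | h
    · rw [b1]; exact hq
    rcases (Nat.succ_le_of_lt h).eq_or_lt with h | h
    · rw [← h]; exact b2 ▸ div_ne_zero (hW _ hks) hq
    · rw [b3 n h]; exact hB n
  have pad : ∀ j ≤ k, (contFrac a b).nums (2 * j) = 0 ∧ (contFrac a b).dens (2 * j) = 1 ∧
      (contFrac a b).nums (2 * j + 1) = 1 ∧ (contFrac a b).dens (2 * j + 1) = 0 := by
    intro j hj
    induction j with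
    | zero =>
      rw [mul_zero, contFrac_nums_zero, contFrac_dens_zero, contFrac_nums_one, contFrac_dens_one,
        a0 0 (by omega), a0 1 (by omega), b0 0 (by omega)]
      simp
    | succ j ih =>
      obtain ⟨h1, h2, h3, h4⟩ := ih (by omega)
      rw [show 2 * (j + 1) + 1 = 2 * j + 1 + 2 by ring, show 2 * (j + 1) = 2 * j + 2 by ring]
      simp only [contFrac_nums_succ_succ, contFrac_dens_succ_succ, h1, h2, h3, h4,
        a0 (2 * j + 2) (by omega), a0 (2 * j + 1 + 2) (by omega), b0 (2 * j + 1) (by omega),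
        b0 (2 * j + 1 + 1) (by omega)]
      simp
  have main : ∀ n ≥ s + 1, ((contFrac a b).nums n = P n ∧ (contFrac a b).dens n = Q n) ∧
      ((contFrac a b).nums (n + 1) = P (n + 1) ∧ (contFrac a b).dens (n + 1) = Q (n + 1)) := by
    intro n hn
    induction n, hn using Nat.le_induction with
    | base =>
      obtain ⟨h1, h2, h3, h4⟩ := pad k le_rfl
      rw [← hs] at h3 h4
      have e1 : (contFrac a b).nums (s + 1) = P (s + 1) := by
        rw [hs, show 2 * k + 1 + 1 = 2 * k + 2 by ring, contFrac_nums_succ_succ,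
          show 2 * k + 2 = s + 1 by omega, show 2 * k + 1 = s by omega, h1, h3, a1]
        simp
      have e2 : (contFrac a b).dens (s + 1) = Q (s + 1) := by
        rw [hs, show 2 * k + 1 + 1 = 2 * k + 2 by ring, contFrac_dens_succ_succ,
          show 2 * k + 2 = s + 1 by omega, show 2 * k + 1 = s by omega, h2, h4, b1]
        simp
      have hq' : (Q (s + 1) : ℝ) ≠ 0 := by exact_mod_cast hq
      refine ⟨⟨e1, e2⟩, ?_, ?_⟩
      · rw [show s + 1 + 1 = s + 2 from rfl, contFrac_nums_succ_succ, e1, h3, a2, b2, casoratian]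
        push_cast
        field_simp
        ring
      · rw [show s + 1 + 1 = s + 2 from rfl, contFrac_dens_succ_succ, e2, h4, a2]
        push_cast
        field_simp
        ring
    | succ n hn ih =>
      obtain ⟨⟨h1, h2⟩, h3, h4⟩ := ih
      refine ⟨⟨h3, h4⟩, ?_, ?_⟩
      · rw [show n + 1 + 1 = n + 2 from rfl, contFrac_nums_succ_succ, h1, h3,
          hP n (by omega), a3 _ (by omega), b3 _ (by omega)]
        push_cast; rfl
      · rw [show n + 1 + 1 = n + 2 from rfl, contFrac_dens_succ_succ, h2, h4,
          hQ n (by omega), a3 _ (by omega), b3 _ (by omega)]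
        push_cast; rfl
  exact eventually_atTop.mpr ⟨s + 1, fun n hn => (main n hn).1⟩

end ContinuedFraction

/-! ### Application to the second family: representation and error term. -/

section Family

theorem eval_secondA (u v w k : ℕ) (x : ℚ) :
    (secondA u v w k).eval x = 8 * recA (w : ℚ) (v + w : ℕ) (u + v + w : ℕ)
      (w + (v + w) + (u + v + w) + 2 * k + 1 : ℕ) (x + (u + v + w : ℕ) - 1 / 2) := by
  simp [secondA, recA]
  ring

theorem eval_secondB (u v w : ℕ) (x : ℚ) :
    (secondB u v w).eval x = 64 * recB (w : ℚ) (v + w : ℕ) (u + v + w : ℕ)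
      (x + (u + v + w : ℕ) - 1 / 2) := by
  simp [secondB, recB]
  ring

theorem eval_secondB_ne_zero (u v w n : ℕ) : (secondB u v w).eval (n : ℚ) ≠ 0 := by
  have odd : ∀ j : ℕ, (2 * (j : ℚ) - 1) ≠ 0 := fun j h => by
    have : (2 * (j : ℤ) - 1) = 0 := by exact_mod_cast h
    omega
  have e : (secondB u v w).eval (n : ℚ) = -((2 * (n : ℚ) - 1) * (2 * (n + u : ℕ) - 1) *
      (2 * (n + u + v : ℕ) - 1) * (2 * (n + u + v + 2 * w : ℕ) - 1) *
      (2 * (n + u + 2 * v + 2 * w : ℕ) - 1) * (2 * (n + 2 * u + 2 * v + 2 * w : ℕ) - 1)) := by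
    simp [secondB]
    ring
  rw [e]
  simp only [neg_ne_zero, mul_ne_zero_iff]
  exact ⟨⟨⟨⟨⟨odd _, odd _⟩, odd _⟩, odd _⟩, odd _⟩, odd _⟩

theorem second_eq_first_comp (u v w k : ℕ) :
    secondA u v w k = 8 * (firstA u v w k).comp (X - C (1 / 2 : ℚ)) ∧
      secondB u v w = 64 * (firstB u v w).comp (X - C (1 / 2 : ℚ)) := by
  constructor <;> refine Polynomial.funext fun x => ?_
  · simp [secondA, firstA]; ring
  · simp [secondB, firstB]; ring

theorem tendsto_combination_div {T : ℕ → ℝ} {a b c d : ℝ} (hT : Tendsto T atTop (𝓝 0))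
    (hc : c ≠ 0) : Tendsto (fun m => (a + b * T m) / (c + d * T m)) atTop (𝓝 (a / c)) := by
  have := ((hT.const_mul b).const_add a).div ((hT.const_mul d).const_add c) (by simpa using hc)
  simp only [mul_zero, add_zero] at this
  exact this

theorem represents_second (u v w k : ℕ) :
    Represents (secondA u v w k) (secondB u v w) zetaThree := by
  obtain ⟨P, Q, hP, hQ, hW, hlim⟩ := hasRationalPair w (v + w) (u + v + w) k
  obtain ⟨τ, hτ⟩ : ∃ τ, τ = w + (v + w) + (u + v + w) + 2 * k + 1 := ⟨_, rfl⟩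
  have hτ1 : 1 ≤ τ := by omega
  rw [← hτ] at hP hQ hlim
  obtain ⟨γ, hγ⟩ : ∃ γ, γ = u + v + w := ⟨_, rfl⟩
  obtain ⟨D, T, l, hl, c, hc, hD, hT, hY⟩ := exists_basis w (v + w : ℕ) (u + v + w : ℕ) hτ1
  have hT0 := tendsto_zero_of_tendsto_mul_pow (by omega) hT
  have hP' := hP.ratCast
  have hQ' := hQ.ratCast
  have he := hP'.sub_mul hQ' zetaThree
  simp only [Rat.cast_natCast] at hQ' he
  obtain ⟨a₁, b₁, h₁⟩ := hY _ he
  obtain ⟨a₂, b₂, h₂⟩ := hY _ hQ'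
  have ha : a₁ = 0 := by
    have h1 := hD.mul ((hT0.const_mul b₁).const_add a₁)
    have h2 := tendsto_nhds_unique (h1.congr' (by
      filter_upwards [h₁] with m hm
      rw [hm]; ring)) hlim
    simpa [hl] using h2
  have hdet := det_ne_zero_of_casoratian h₁ h₂ (by
    filter_upwards [hW] with m hm
    have : ((casoratian P Q m : ℚ) : ℝ) ≠ 0 := by exact_mod_cast hm
    convert this using 1
    simp only [casoratian]; push_cast; ring)
  have hc₂ : a₂ ≠ 0 := by
    rintro rfl
    simp [ha] at hdet
  have hD0 : ∀ᶠ m in atTop, D m ≠ 0 := by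
    filter_upwards [hD.eventually_ne hl] with m hm h0
    simp [h0] at hm
  have hden : ∀ᶠ m in atTop, a₂ + b₂ * T m ≠ 0 :=
    ((hT0.const_mul b₂).const_add a₂).eventually_ne (by simpa using hc₂)
  have hQ0 : ∀ᶠ m in atTop, Q m ≠ 0 := by
    filter_upwards [h₂, hD0, hden] with m h1 h2 h3 h0
    rw [h0, Rat.cast_zero] at h1
    exact mul_ne_zero h2 h3 h1.symm
  have hconv : Tendsto (fun m => (P m : ℝ) / Q m) atTop (𝓝 zetaThree) := by
    have h3 := (tendsto_combination_div (a := a₁) (b := b₁) (d := b₂) hT0 hc₂).add_const zetaThree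
    rw [ha, zero_div, zero_add, ← ha] at h3
    refine h3.congr' ?_
    filter_upwards [h₁, h₂, hD0, hQ0] with m h1 h2 h4 h5
    have h6 : (Q m : ℝ) ≠ 0 := by exact_mod_cast h5
    rw [← mul_div_mul_left _ _ h4, ← h1, ← h2]
    field_simp
    ring
  obtain ⟨K, hK⟩ := eventually_atTop.mp (hP.and (hQ.and (hQ0.and hW)))
  have e1 : ∀ n : ℕ, ((n + γ : ℕ) : ℚ) + 3 / 2 = (n + 2 : ℕ) + (γ : ℕ) - 1 / 2 := fun n => by
    push_cast; ring
  have e2 : ∀ n : ℕ, ((n + γ : ℕ) : ℚ) + 1 / 2 = (n + 1 : ℕ) + (γ : ℕ) - 1 / 2 := fun n => by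
    push_cast; ring
  -- Since `A = 8 recA` and `B = 64 recB`, scaling by `8 ^ n` passes from the centred recurrence to
  -- that of `(A, B)`.
  have hrec : ∀ x : ℕ → ℚ, ∀ n : ℕ,
      x (n + γ + 2) = recA (w : ℚ) (v + w : ℕ) (u + v + w : ℕ) τ ((n + γ : ℕ) + 3 / 2)
        * x (n + γ + 1) + recB (w : ℚ) (v + w : ℕ) (u + v + w : ℕ) ((n + γ : ℕ) + 1 / 2)
        * x (n + γ) →
      8 ^ (n + 2) * x (n + 2 + γ) =
        (secondA u v w k).eval ((n + 2 : ℕ) : ℚ) * (8 ^ (n + 1) * x (n + 1 + γ)) +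
        (secondB u v w).eval ((n + 1 : ℕ) : ℚ) * (8 ^ n * x (n + γ)) := by
    intro x n h
    rw [eval_secondA, eval_secondB, ← hτ, ← hγ, ← e1, ← e2, hγ, ← hγ,
      show n + 2 + γ = n + γ + 2 by ring, show n + 1 + γ = n + γ + 1 by ring, h, ← hγ]
    ring
  obtain ⟨a, b, hb, hab, hnd⟩ := exists_contFrac_of_recurrence
    (A := fun n => (secondA u v w k).eval (n : ℚ)) (B := fun n => (secondB u v w).eval (n : ℚ))
    (P := fun n => 8 ^ n * P (n + γ)) (Q := fun n => 8 ^ n * Q (n + γ)) (k := K)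
    (eval_secondB_ne_zero u v w) (fun n hn => hrec P n (hK (n + γ) (by omega)).1)
    (fun n hn => hrec Q n (hK (n + γ) (by omega)).2.1)
    (fun n hn => mul_ne_zero (by positivity) (hK (n + γ) (by omega)).2.2.1)
    (fun n hn => by
      have h1 := (hK (n + γ) (by omega)).2.2.2
      have : casoratian (fun n => 8 ^ n * P (n + γ)) (fun n => 8 ^ n * Q (n + γ)) n =
          8 ^ (2 * n + 1) * casoratian P Q (n + γ) := by
        simp only [casoratian]
        rw [show n + 1 + γ = n + γ + 1 by ring]
        ring
      rw [this]
      exact mul_ne_zero (by positivity) h1)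
  refine ⟨a, b, hb, ⟨?_, ?_⟩, hab⟩
  · filter_upwards [hnd, (tendsto_add_atTop_nat γ).eventually hQ0] with n h1 h2
    rw [h1.2]
    exact_mod_cast mul_ne_zero (by positivity) h2
  · refine (hconv.comp (tendsto_add_atTop_nat γ)).congr' ?_
    filter_upwards [hnd] with n h1
    rw [contFrac_convs, h1.1, h1.2]
    push_cast
    rw [mul_div_mul_left _ _ (by positivity)]
    rfl

theorem isEquivalent_error (u v w k : ℕ) {z : ℝ} {a b : ℕ → ℚ}
    (h : IsRepresentation (secondA u v w k) (secondB u v w) z a b) :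
    ∃ c : ℝ, c ≠ 0 ∧ (fun n : ℕ => z - (contFrac a b).convs n) ~[atTop]
      (fun n : ℕ => c / (n : ℝ) ^ (2 * u + 4 * v + 6 * w + 4 * k + 2)) := by
  obtain ⟨hb, ⟨hq0, hconv⟩, hev⟩ := h
  obtain ⟨τ, hτ⟩ : ∃ τ, τ = w + (v + w) + (u + v + w) + 2 * k + 1 := ⟨_, rfl⟩
  have hτ1 : 1 ≤ τ := by omega
  obtain ⟨γ, hγ⟩ : ∃ γ, γ = u + v + w := ⟨_, rfl⟩
  obtain ⟨D, T, l, hl, c, hc, hD, hT, hY⟩ := exists_basis w (v + w : ℕ) (u + v + w : ℕ) hτ1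
  have hT0 := tendsto_zero_of_tendsto_mul_pow (by omega) hT
  have hD0 : ∀ᶠ m in atTop, D m ≠ 0 := by
    filter_upwards [hD.eventually_ne hl] with m hm h0
    simp [h0] at hm
  have hsol : ∀ x : ℕ → ℝ,
      (∀ n, x (n + 2) = (a (n + 2) : ℝ) * x (n + 1) + b (n + 1) * x n) →
      IsSol (w : ℝ) (v + w : ℕ) (u + v + w : ℕ) τ fun m => x (m - γ) / 8 ^ m := by
    intro x hx
    -- Only `m ≥ γ` matters, so with `m = n + γ` the truncated subtraction is exact.
    rw [IsSol, ← map_add_atTop_eq_nat γ, eventually_map]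
    filter_upwards [(tendsto_add_atTop_nat 2).eventually hev,
      (tendsto_add_atTop_nat 1).eventually hev] with n h1 h2
    have e1 : ((n + 2 : ℕ) : ℚ) + (γ : ℕ) - 1 / 2 = (n + γ : ℕ) + 3 / 2 := by push_cast; ring
    have e2 : ((n + 1 : ℕ) : ℚ) + (γ : ℕ) - 1 / 2 = (n + γ : ℕ) + 1 / 2 := by push_cast; ring
    have h3 := h1.1
    have h4 := h2.2
    rw [eval_secondA, ← hτ, ← hγ, e1] at h3
    rw [eval_secondB, ← hγ, e2] at h4
    have h3' : (a (n + 2) : ℝ) = 8 * recA (w : ℝ) (v + w : ℕ) γ τ ((n + γ : ℕ) + 3 / 2) := by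
      rw [h3]; simp only [recA]; push_cast; ring
    have h4' : (b (n + 1) : ℝ) = 64 * recB (w : ℝ) (v + w : ℕ) γ ((n + γ : ℕ) + 1 / 2) := by
      rw [h4]; simp only [recB]; push_cast; ring
    rw [show n + γ + 2 - γ = n + 2 by omega, show n + γ + 1 - γ = n + 1 by omega,
      show n + γ - γ = n by omega, hx, h3', h4', ← hγ]
    field_simp
    ring
  have hcomb : ∀ x : ℕ → ℝ,
      (∀ n, x (n + 2) = (a (n + 2) : ℝ) * x (n + 1) + b (n + 1) * x n) →
      ∃ r s : ℝ, ∀ᶠ n in atTop, x n = 8 ^ (n + γ) * D (n + γ) * (r + s * T (n + γ)) := by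
    intro x hx
    obtain ⟨r, s, h⟩ := hY _ (hsol x hx)
    refine ⟨r, s, ?_⟩
    filter_upwards [(tendsto_add_atTop_nat γ).eventually h] with n hn
    rw [Nat.add_sub_cancel, div_eq_iff (by positivity)] at hn
    rw [hn]; ring
  obtain ⟨a₁, b₁, h₁⟩ := hcomb (fun j => (contFrac a b).nums j) (contFrac_nums_succ_succ a b)
  obtain ⟨a₂, b₂, h₂⟩ := hcomb (fun j => (contFrac a b).dens j) (contFrac_dens_succ_succ a b)
  have hdet : a₁ * b₂ - b₁ * a₂ ≠ 0 :=
    det_ne_zero_of_casoratian (D := fun n => 8 ^ (n + γ) * D (n + γ)) (T := fun n => T (n + γ))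
      h₁ h₂ (Eventually.of_forall (contFrac_det_ne_zero hb))
  have hTγ : Tendsto (fun n => T (n + γ)) atTop (𝓝 0) := hT0.comp (tendsto_add_atTop_nat γ)
  have hDγ : ∀ᶠ n in atTop, 8 ^ (n + γ) * D (n + γ) ≠ 0 := by
    filter_upwards [(tendsto_add_atTop_nat γ).eventually hD0] with n hn
    exact mul_ne_zero (by positivity) hn
  have hcv : ∀ᶠ n in atTop, (contFrac a b).convs n =
      (a₁ + b₁ * T (n + γ)) / (a₂ + b₂ * T (n + γ)) := by
    filter_upwards [h₁, h₂, hDγ] with n h1 h2 h3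
    rw [contFrac_convs, h1, h2, mul_div_mul_left _ _ h3]
  -- If `a₂ = 0`, the convergents are `(a₁ + b₁ T) / (b₂ T)` with `a₁ ≠ 0`; multiplied by the
  -- reciprocal, which tends to `0`, they would give `1 = z * 0`.
  have ha₂ : a₂ ≠ 0 := by
    rintro rfl
    have ha₁ : a₁ ≠ 0 := by
      rintro rfl
      simp at hdet
    have h3 := hconv.mul (tendsto_combination_div (a := 0) (b := b₂) (d := b₁) hTγ ha₁)
    rw [zero_div, mul_zero] at h3
    have h4 : ∀ᶠ n in atTop, a₁ + b₁ * T (n + γ) ≠ 0 :=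
      ((hTγ.const_mul b₁).const_add a₁).eventually_ne (by simpa using ha₁)
    have h5 := h3.congr' (f₂ := fun _ => (1 : ℝ)) (by
      filter_upwards [hcv, h4, hq0, h₂] with n g1 g2 g3 g4
      rw [g4] at g3
      rw [g1]
      rw [div_mul_div_comm, mul_comm, div_self (mul_ne_zero (right_ne_zero_of_mul g3) g2)])
    exact one_ne_zero (tendsto_nhds_unique tendsto_const_nhds h5)
  have hz : z = a₁ / a₂ :=
    tendsto_nhds_unique hconv ((tendsto_combination_div (b := b₁) (d := b₂) hTγ ha₂).congr'
      (hcv.mono fun n hn => hn.symm))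
  have hden : ∀ᶠ n in atTop, a₂ + b₂ * T (n + γ) ≠ 0 :=
    ((hTγ.const_mul b₂).const_add a₂).eventually_ne (by simpa using ha₂)
  have hexp : 2 * u + 4 * v + 6 * w + 4 * k + 2 = 2 * τ := by rw [hτ]; ring
  have hTn : Tendsto (fun n : ℕ => T (n + γ) * (n : ℝ) ^ (2 * τ)) atTop (𝓝 c) := by
    have g1 : Tendsto (fun n : ℕ => ((n : ℝ) / ((n : ℝ) + γ)) ^ (2 * τ)) atTop (𝓝 1) := by
      simpa using (tendsto_natCast_div_add_atTop (γ : ℝ)).pow (2 * τ)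
    have g2 := (hT.comp (tendsto_add_atTop_nat γ)).mul g1
    rw [mul_one] at g2
    refine g2.congr' ?_
    filter_upwards [eventually_ge_atTop 1] with n hn
    have : (0 : ℝ) < n := by exact_mod_cast hn
    simp only [Function.comp]
    push_cast
    rw [div_pow]
    field_simp
  -- With `z = a₁ / a₂` the error is exactly `(a₁ b₂ - b₁ a₂) T / (a₂ (a₂ + b₂ T))`.
  have hlim : Tendsto (fun n : ℕ => (z - (contFrac a b).convs n) * (n : ℝ) ^ (2 * τ)) atTop
      (𝓝 ((a₁ * b₂ - b₁ * a₂) * c / (a₂ * a₂))) := by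
    have g1 := ((hTn.const_mul (a₁ * b₂ - b₁ * a₂)).div
      (((hTγ.const_mul b₂).const_add a₂).const_mul a₂) (by simpa using ha₂))
    rw [mul_zero, add_zero] at g1
    refine g1.congr' ?_
    filter_upwards [hcv, hden] with n g2 g3
    simp only [Pi.div_apply]
    rw [g2, hz]
    field_simp
    ring
  have hC : (a₁ * b₂ - b₁ * a₂) * c / (a₂ * a₂) ≠ 0 :=
    div_ne_zero (mul_ne_zero hdet hc) (mul_ne_zero ha₂ ha₂)
  refine ⟨_, hC, ?_⟩
  rw [hexp]
  refine isEquivalent_of_tendsto_one ?_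
  have g := hlim.div_const ((a₁ * b₂ - b₁ * a₂) * c / (a₂ * a₂))
  rw [div_self hC] at g
  refine g.congr fun n => ?_
  simp only [Pi.div_apply, div_div_eq_mul_div]

end Family

end ParamCF

end

theorem mainTheorem9 (u v w k : ℕ) :
    (ParamCF.secondA u v w k = 8 * (ParamCF.firstA u v w k).comp (X - C (1 / 2 : ℚ)) ∧
      ParamCF.secondB u v w = 64 * (ParamCF.firstB u v w).comp (X - C (1 / 2 : ℚ))) ∧
    ParamCF.Represents (ParamCF.secondA u v w k) (ParamCF.secondB u v w) ParamCF.zetaThree ∧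
    ∀ a b : ℕ → ℚ,
      ParamCF.IsRepresentation (ParamCF.secondA u v w k) (ParamCF.secondB u v w)
        ParamCF.zetaThree a b →
      ∃ c : ℝ, c ≠ 0 ∧
        (fun n : ℕ => ParamCF.zetaThree - (ParamCF.contFrac a b).convs n) ~[atTop]
          (fun n : ℕ => c / (n : ℝ) ^ (2 * u + 4 * v + 6 * w + 4 * k + 2)) :=
  ⟨ParamCF.second_eq_first_comp u v w k, ParamCF.represents_second u v w k,
    fun _ _ h => ParamCF.isEquivalent_error u v w k h⟩
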